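/- **Setting.** Let $d\ge 0$, $T\ge 1$ be integers, $\epsilon>0$, $0<\beta_2\le 1$. Let $\mathcal H$ be a well-structured preconditioner set, i.e. $\mathcal H=\mathcal S_+^d\cap\mathcal K$, where $\mathcal S_+^d$ is the set of real symmetric positive semidefinite $d\times d$ matrices and $\mathcal K\subseteq\mathbb R^{d\times d}$ is a linear subspace closed under matrix multiplication and containing $I_d$. Write $\langle A,B\rangle=\mathrm{Tr}(A^\top B)$ and $\|x\|_H=\sqrt{x^\top Hx}$; every expression containing $H^{-1}$ refers to invertible $H$. Put $\|x\|_{\mathcal H}=\sup_{H\in\mathcal H,\ \mathrm{Tr}(H)\le 1}\|x\|_H$. Let $\mathcal X\subseteq\mathbb R^d$ be convex and bounded, and put $\|\mathcal X\|_{\mathcal H}=\sup_{x\in\mathcal X}\|x\|_{\mathcal H}$. **Losses.** Let $\tilde L_1,\dots,\tilde L_T$ be independent random functions $\mathbb R^d\to\mathbb R$ (each $\tilde L_t(x)$ being a random variable) that are convex and differentiable, with common expectation $\tilde L:\mathbb R^d\to\mathbb R$: $\tilde L_t(x)$ is integrable and $\mathbb E[\tilde L_t(x)]=\tilde L(x)$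 for all $t$ and all $x$ in some convex set $U\supseteq\mathcal X$ with nonempty interior (for instance $U=\mathbb R^d$, or $U=\mathcal X$ if $\mathcal X$ has an interior point). Suppose that for some $\Sigma\in\mathcal S_+^d$, $$\mathbb E\big[(\nabla\tilde L_t(x)-\nabla\tilde L(x))(\nabla\tilde L_t(x)-\nabla\tilde L(x))^\top\big]\preceq\Sigma\qquad\text{for all } t\in\{1,\dots,T\},\ x\in\mathcal X$$ (in particular this expectation exists), and put $\sigma=\inf_{H\in\mathcal H,\ \mathrm{Tr}(H)\le1}\sqrt{\langle\Sigma,H^{-1}\rangle}$. Suppose that $\tilde L$ is twice differentiable and that its $\mathcal H$-smoothness $$H(\tilde L,\mathcal H)=\inf\{\mathrm{Tr}(H^*) : H^*\in\mathcal H,\ -H^*\preceq\nabla^2\tilde L(x)\preceq H^*\text{ for all }x\in\mathbb R^d\}$$ is finite, and that $\tilde L$ has a global minimizer $x^*\in\mathcal X$. **Algorithm.** Let $x_1\in\mathcal X$ be deterministic, $\eta=\sqrt2\,\|\mathcal X\|_{\mathcal H}$, $M_0=\epsilon I_d$, and let the iterates satisfy, for $t=1,\dots,T$, $$g_t=\nabla\tilde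 L_t(x_t),\qquad M_t=\beta_2M_{t-1}+g_tg_t^\top,\qquad H_t=\operatorname*{arg\,min}_{H\in\mathcal H}\ \langle M_t,H^{-1}\rangle+\eta^2\,\mathrm{Tr}(H),$$ $$x_{t+1}=\operatorname*{arg\,min}_{x'\in\mathcal X}\ \|x_t-H_t^{-1}g_t-x'\|_{H_t}.$$ **Theorem.** With $\bar x_{1:T}=\big(\sum_{t=1}^T\beta_2^{(T-t)/2}\big)^{-1}\sum_{t=1}^T\beta_2^{(T-t)/2}x_t$, the random variable $\tilde L(\bar x_{1:T})$ is integrable and $$\mathbb E\big[\tilde L(\bar x_{1:T})\big]-\tilde L(x^*)\ \le\ \frac{16}{\sum_{t=1}^T\beta_2^{\frac{T-t}{2}}}\|\mathcal X\|_{\mathcal H}^2\,H(\tilde L,\mathcal H)+\frac{4\sqrt2}{\sqrt{\sum_{t=1}^T\beta_2^{T-t}}}\|\mathcal X\|_{\mathcal H}\,\sigma+\frac{4\sqrt2}{\sum_{t=1}^T\beta_2^{-\frac t2}}\|\mathcal X\|_{\mathcal H}\,d\sqrt\epsilon .$$ -/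

import Mathlib

open MeasureTheory ProbabilityTheory
open scoped Matrix

noncomputable section

namespace AdaReg

/-- Euclidean space `ℝ^d`. -/
abbrev Vec (d : ℕ) : Type := EuclideanSpace ℝ (Fin d)

/-- Real `d × d` matrices. -/
abbrev Mat (d : ℕ) : Type := Matrix (Fin d) (Fin d) ℝ

/-- A well-structured preconditioner set: all positive semidefinite matrices that belong to some
subalgebra of the `d × d` matrices containing the identity. -/
def IsWellStructured {d : ℕ} (𝓗 : Set (Mat d)) : Prop :=
  ∃ K : Subalgebra ℝ (Mat d), 𝓗 = {H | H.PosSemidef ∧ H ∈ K}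

/-- The inner product `⟨A, B⟩ = Tr (Aᵀ B)`. -/
def matInner {d : ℕ} (A B : Mat d) : ℝ := (Aᵀ * B).trace

/-- The (semi-)norm `‖x‖_H = √(xᵀ H x)`. -/
def matNorm {d : ℕ} (H : Mat d) (x : Vec d) : ℝ := √(x.ofLp ⬝ᵥ H *ᵥ x.ofLp)

/-- `‖x‖_𝓗 = sup {‖x‖_H : H ∈ 𝓗, Tr H ≤ 1}`. -/
def setNorm {d : ℕ} (𝓗 : Set (Mat d)) (x : Vec d) : ℝ :=
  sSup {r | ∃ H ∈ 𝓗, H.trace ≤ 1 ∧ r = matNorm H x}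

/-- `‖𝓧‖_𝓗 = sup {‖x‖_𝓗 : x ∈ 𝓧}`. -/
def domainNorm {d : ℕ} (𝓗 : Set (Mat d)) (X : Set (Vec d)) : ℝ :=
  sSup (setNorm 𝓗 '' X)

/-- `inf {√⟨S, H⁻¹⟩ : H ∈ 𝓗, Tr H ≤ 1}`, over those `H` that are invertible
(equivalently, positive definite). -/
def noiseLevel {d : ℕ} (𝓗 : Set (Mat d)) (S : Mat d) : ℝ :=
  sInf {r | ∃ H ∈ 𝓗, H.PosDef ∧ H.trace ≤ 1 ∧ r = √(matInner S H⁻¹)}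

/-- The Hessian matrix `∇² L (x)`. -/
def hessian {d : ℕ} (L : Vec d → ℝ) (x : Vec d) : Mat d :=
  Matrix.of fun i j =>
    fderiv ℝ (fderiv ℝ L) x (EuclideanSpace.single i 1) (EuclideanSpace.single j 1)

/-- `L` is twice differentiable and `-H ≼ ∇² L (x) ≼ H` for every `x`. -/
structure HessianBoundedBy {d : ℕ} (L : Vec d → ℝ) (H : Mat d) : Prop where
  differentiable : Differentiable ℝ L
  differentiable_fderiv : Differentiable ℝ (fderiv ℝ L)
  upper : ∀ x, (H - hessian L x).PosSemidef
  lower : ∀ x, (hessian L x - -H).PosSemidef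

/-- `L` is `𝓗`-smooth, i.e. its `𝓗`-smoothness is finite. -/
def IsSmooth {d : ℕ} (L : Vec d → ℝ) (𝓗 : Set (Mat d)) : Prop :=
  ∃ H ∈ 𝓗, HessianBoundedBy L H

/-- The `𝓗`-smoothness `H(L, 𝓗)` of an `𝓗`-smooth function. -/
def smoothness {d : ℕ} (L : Vec d → ℝ) (𝓗 : Set (Mat d)) : ℝ :=
  sInf {h | ∃ H ∈ 𝓗, HessianBoundedBy L H ∧ h = H.trace}

/-- `H` minimizes `⟨M, H⁻¹⟩ + η² Tr H` over the invertible members of `𝓗`. -/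
structure IsPreconditioner {d : ℕ} (𝓗 : Set (Mat d)) (η : ℝ) (M H : Mat d) : Prop where
  mem : H ∈ 𝓗
  posDef : H.PosDef
  le : ∀ H' ∈ 𝓗, H'.PosDef →
    matInner M H⁻¹ + η ^ 2 * H.trace ≤ matInner M H'⁻¹ + η ^ 2 * H'.trace

/-- `z` is the projection of `y` onto `X` with respect to `‖·‖_H`. -/
structure IsProjection {d : ℕ} (X : Set (Vec d)) (H : Mat d) (y z : Vec d) : Prop where
  mem : z ∈ X
  le : ∀ z' ∈ X, matNorm H (y - z) ≤ matNorm H (y - z')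

/-- `x 1, x 2, …` (with accumulators `M t` and preconditioners `H t`) is the run of `T` steps of
the weighted adaptive regularization algorithm with initial point `x₁` on the losses
`ℓ 1, …, ℓ T`. -/
structure IsWeightedRun {d : ℕ} (T : ℕ) (𝓗 : Set (Mat d)) (X : Set (Vec d)) (ε η β : ℝ)
    (x₁ : Vec d) (ℓ : ℕ → Vec d → ℝ) (x : ℕ → Vec d) (M H : ℕ → Mat d) : Prop where
  init : x 1 = x₁
  accum_zero : M 0 = ε • (1 : Mat d)
  accum_step : ∀ t ∈ Finset.Icc 1 T, M t = β • M (t - 1) +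
    Matrix.vecMulVec (gradient (ℓ t) (x t)).ofLp (gradient (ℓ t) (x t)).ofLp
  precond : ∀ t ∈ Finset.Icc 1 T, IsPreconditioner 𝓗 η (M t) (H t)
  step : ∀ t ∈ Finset.Icc 1 T, IsProjection X (H t)
    (x t - WithLp.toLp 2 ((H t)⁻¹ *ᵥ (gradient (ℓ t) (x t)).ofLp)) (x (t + 1))

/-- The weighted average
`(∑_{t=1}^T β^{(T-t)/2})⁻¹ ∑_{t=1}^T β^{(T-t)/2} x_t`. -/
def weightedAverage {d : ℕ} (T : ℕ) (β : ℝ) (x : ℕ → Vec d) : Vec d :=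
  (∑ t ∈ Finset.Icc 1 T, β ^ (((T : ℝ) - t) / 2))⁻¹ •
    ∑ t ∈ Finset.Icc 1 T, β ^ (((T : ℝ) - t) / 2) • x t

/-- The matrix `(∇ℓ(x) - ∇L(x)) (∇ℓ(x) - ∇L(x))ᵀ`. -/
def noiseOuter {d : ℕ} (ℓ L : Vec d → ℝ) (x : Vec d) : Mat d :=
  Matrix.vecMulVec (gradient ℓ x - gradient L x).ofLp (gradient ℓ x - gradient L x).ofLp

/-- Second moment bound for the gradient noise at every point of `X`: the entries of the matrix
`(∇ℓ(x) - ∇L(x)) (∇ℓ(x) - ∇L(x))ᵀ` are integrable and its expectation is at most `S`. -/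
def NoiseBoundedBy {d : ℕ} {Ω : Type*} [MeasurableSpace Ω] (μ : Measure Ω) (X : Set (Vec d))
    (ℓ : Ω → Vec d → ℝ) (L : Vec d → ℝ) (S : Mat d) : Prop :=
  ∀ x ∈ X, (∀ i j, Integrable (fun ω => noiseOuter (ℓ ω) L x i j) μ) ∧
    (S - Matrix.of fun i j => ∫ ω, noiseOuter (ℓ ω) L x i j ∂μ).PosSemidef

end AdaReg

end

noncomputable section

namespace AdaReg

open Filter Topology

variable {d : ℕ}

/-! Put `w_t = β^((T-t)/2)` and `R = ‖X‖_𝓗`. Weighting is only a change of scale: `w_t² M_t` and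
`w_t H_t` are the accumulators and preconditioners of the unweighted method fed with the gradients
`w_t g_t`. For that method the regret is at most `⟨M_T, Q⁻¹⟩ + 2R² Tr Q` for every invertible `Q ∈
𝓗` (`regret_bound`, `IsWeightedRun.regret_le`). The proof combines the be-the-leader argument with
telescoping of the distances to the comparator, which works because the preconditioners increase.
Monotonicity comes from the optimality condition `⟨M, D⟩ = η² Tr(HDH)` for symmetric `D` in the
algebra, together with a negative-part argument (`posSemidef_sub_of_trace_le`).

Since `Q` is free, a deterministic one can be chosen before taking expectations: `Q = 4P + aJ + cI`,
where `P` bounds the Hessian of `L`, `J` is a competitor for the noise level, and `cI` controls the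
`ε` term. Each summand bounds `Q⁻¹` from above in its own way. Noise contributes `⟨S, J⁻¹⟩/a`;
smoothness and the global minimum give `∇Lᵀ Q⁻¹ ∇L ≤ (L - L(x*))/2`, which is absorbed into the left
side because `β^(T-t) ≤ w_t` (`sum_suboptimality_le`). Optimizing `a` and `c`, passing to the infima
over `P` and `J`, and applying Jensen's inequality finish the estimate.

Taking expectations requires the iterate `x_t` to be measurable and independent of the `t`-th loss.
The run is given only pointwise as a sequence of minimizers, so measurability is derived from
uniqueness of the minimizers (`measurable_of_graph`). Unbiasedness of the gradients is
differentiation under the integral, dominated through convexity (`integral_gradient`). -/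

/-! ### Positive semidefinite matrices and the trace inner product. -/

lemma posSemidef_quad_nonneg {A : Mat d} (hA : A.PosSemidef) (v : Fin d → ℝ) :
    0 ≤ v ⬝ᵥ A *ᵥ v := by
  simpa using hA.dotProduct_mulVec_nonneg v

lemma posSemidef_of_quad_nonneg {A : Mat d} (hA : Aᵀ = A) (h : ∀ v : Fin d → ℝ, 0 ≤ v ⬝ᵥ A *ᵥ v) :
    A.PosSemidef :=
  .of_dotProduct_mulVec_nonneg (by simpa [Matrix.IsHermitian] using hA) (by simpa using h)

lemma transpose_eq_of_posSemidef {A : Mat d} (hA : A.PosSemidef) : Aᵀ = A := by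
  simpa [Matrix.IsHermitian] using hA.isHermitian

lemma dotProduct_mulVec_comm {A : Mat d} (hA : Aᵀ = A) (u v : Fin d → ℝ) :
    u ⬝ᵥ A *ᵥ v = v ⬝ᵥ A *ᵥ u := by
  rw [Matrix.dotProduct_mulVec, ← Matrix.mulVec_transpose, hA, dotProduct_comm]

lemma trace_mul_nonneg {A B : Mat d} (hA : A.PosSemidef) (hB : B.PosSemidef) :
    0 ≤ (A * B).trace := by
  open scoped MatrixOrder in
  obtain ⟨C, rfl⟩ := CStarAlgebra.nonneg_iff_eq_star_mul_self.mp hB.nonneg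
  rw [← Matrix.mul_assoc, Matrix.trace_mul_cycle]
  exact (hA.mul_mul_conjTranspose_same C).trace_nonneg

lemma matInner_nonneg {A B : Mat d} (hA : A.PosSemidef) (hB : B.PosSemidef) :
    0 ≤ matInner A B :=
  trace_mul_nonneg hA.transpose hB

lemma matInner_vecMulVec (v : Fin d → ℝ) (A : Mat d) :
    matInner (Matrix.vecMulVec v v) A = v ⬝ᵥ A *ᵥ v := by
  rw [matInner, Matrix.transpose_vecMulVec, Matrix.vecMulVec_mul, Matrix.trace_vecMulVec,
    Matrix.dotProduct_mulVec, dotProduct_comm]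

lemma posSemidef_vecMulVec (v : Fin d → ℝ) : (Matrix.vecMulVec v v).PosSemidef := by
  simpa using Matrix.posSemidef_vecMulVec_self_star v

lemma matInner_add_left (A B C : Mat d) : matInner (A + B) C = matInner A C + matInner B C := by
  simp [matInner, add_mul]

lemma matInner_add_right (A B C : Mat d) : matInner A (B + C) = matInner A B + matInner A C := by
  simp [matInner, mul_add]

lemma matInner_sub_right (A B C : Mat d) : matInner A (B - C) = matInner A B - matInner A C := by
  simp [matInner, mul_sub]

lemma matInner_sub_left (A B C : Mat d) : matInner (A - B) C = matInner A C - matInner B C := by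
  simp [matInner, sub_mul]

lemma matInner_smul_left (c : ℝ) (A B : Mat d) : matInner (c • A) B = c * matInner A B := by
  simp [matInner]

lemma matInner_smul_right (c : ℝ) (A B : Mat d) : matInner A (c • B) = c * matInner A B := by
  simp [matInner]

lemma matInner_one_left (A : Mat d) : matInner 1 A = A.trace := by
  simp [matInner]

lemma continuous_matInner_right (A : Mat d) : Continuous (matInner A) := by
  unfold matInner; fun_prop

/-- Positive definiteness is preserved by small symmetric perturbations. -/
lemma eventually_posDef_add_smul {A D : Mat d} (hA : A.PosDef) (hD : Dᵀ = D) :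
    ∀ᶠ s in 𝓝 (0 : ℝ), (A + s • D).PosDef := by
  -- Compactness of the unit sphere makes the range of `s` uniform in the direction `v`.
  have hK := isCompact_sphere (0 : EuclideanSpace ℝ (Fin d)) 1
  have hev : ∀ᶠ s in 𝓝 (0 : ℝ), ∀ v ∈ Metric.sphere (0 : EuclideanSpace ℝ (Fin d)) 1,
      0 < v.ofLp ⬝ᵥ (A + s • D) *ᵥ v.ofLp := by
    refine hK.eventually_forall_of_forall_eventually fun v hv => ?_
    have hc : Continuous fun z : ℝ × EuclideanSpace ℝ (Fin d) =>
        z.2.ofLp ⬝ᵥ (A + z.1 • D) *ᵥ z.2.ofLp := by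
      have : Continuous fun z : ℝ × EuclideanSpace ℝ (Fin d) => z.2.ofLp :=
        (PiLp.continuous_ofLp 2 _).comp continuous_snd
      fun_prop
    refine hc.continuousAt.eventually (lt_mem_nhds ?_)
    have hv0 : v.ofLp ≠ 0 := by
      intro h
      have : v = 0 := by ext i; simp [h]
      simp [this] at hv
    simpa using hA.dotProduct_mulVec_pos hv0
  filter_upwards [hev] with s hs
  refine .of_dotProduct_mulVec_pos ?_ fun v hv => ?_
  · have hA' := transpose_eq_of_posSemidef hA.posSemidef
    simp [Matrix.IsHermitian, hA', hD]
  · set w : EuclideanSpace ℝ (Fin d) := WithLp.toLp 2 v with hw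
    have hw0 : w ≠ 0 := by
      intro h; apply hv; simpa [hw] using h
    have hn : 0 < ‖w‖ := norm_pos_iff.2 hw0
    have h1 := hs (‖w‖⁻¹ • w) (by simp [norm_smul, hn.ne'])
    have h2 : (‖w‖⁻¹ • w).ofLp = ‖w‖⁻¹ • v := by simp [hw]
    rw [h2, Matrix.mulVec_smul, smul_dotProduct, dotProduct_smul, smul_eq_mul, smul_eq_mul,
      ← mul_assoc] at h1
    simpa using (pos_iff_pos_of_mul_pos h1).1 (by positivity)

/-! ### First-order optimality of the preconditioner. -/

/-- Divide by `s` and let `s` tend to `0` from each side: the two signs give the two inequalities.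
-/
lemma eq_zero_of_eventually_nonneg {a : ℝ} {r : ℝ → ℝ} (hr : ContinuousAt r 0)
    (h : ∀ᶠ s in 𝓝 (0 : ℝ), 0 ≤ s * a + s ^ 2 * r s) : a = 0 := by
  have hlim : Tendsto (fun s => a + s * r s) (𝓝 0) (𝓝 a) := by
    have : ContinuousAt (fun s => a + s * r s) 0 := by fun_prop
    simpa [ContinuousAt] using this
  apply le_antisymm
  · refine le_of_tendsto (hlim.mono_left (nhdsWithin_le_nhds (s := Set.Iio 0))) ?_
    filter_upwards [nhdsWithin_le_nhds h, self_mem_nhdsWithin] with s hs hs0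
    have hs0 : s < 0 := hs0
    by_contra! hc
    nlinarith [mul_pos_of_neg_of_neg hs0 (neg_neg_of_pos hc)]
  · refine ge_of_tendsto (hlim.mono_left (nhdsWithin_le_nhds (s := Set.Ioi 0))) ?_
    filter_upwards [nhdsWithin_le_nhds h, self_mem_nhdsWithin] with s hs hs0
    have hs0 : 0 < s := hs0
    by_contra! hc
    nlinarith [mul_pos hs0 (neg_pos.2 hc)]

/-- The resolvent identity applied twice. Being exact, it reduces the first-order condition to
continuity of the remainder at `s = 0`. -/
lemma inv_add_smul_expansion {A D : Mat d} (s : ℝ) (hA : IsUnit A.det)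
    (hs : IsUnit (A + s • D).det) :
    (A + s • D)⁻¹ = A⁻¹ - s • (A⁻¹ * D * A⁻¹) +
      s ^ 2 • (A⁻¹ * D * (A + s • D)⁻¹ * D * A⁻¹) := by
  set B := A + s • D with hB
  have hD : s • D = B - A := by rw [hB]; abel
  have e1 : s • (A⁻¹ * D * A⁻¹) = A⁻¹ * (s • D) * A⁻¹ := by simp
  have e2 : s ^ 2 • (A⁻¹ * D * B⁻¹ * D * A⁻¹) = A⁻¹ * (s • D) * B⁻¹ * (s • D) * A⁻¹ := by
    simp [smul_smul, pow_two]
  rw [e1, e2, hD]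
  simp only [mul_sub, sub_mul, Matrix.nonsing_inv_mul _ hA, Matrix.mul_assoc,
    Matrix.mul_nonsing_inv _ hA, Matrix.mul_nonsing_inv _ hs, mul_one, one_mul,
    Matrix.nonsing_inv_mul _ hs]
  abel

lemma isUnit_det {A : Mat d} (hA : A.PosDef) : IsUnit A.det :=
  (Matrix.isUnit_iff_isUnit_det A).1 hA.isUnit

/-- First-order optimality condition for the preconditioner. -/
lemma IsPreconditioner.matInner_eq {𝓗 : Set (Mat d)} {K : Subalgebra ℝ (Mat d)}
    (hK : 𝓗 = {H | H.PosSemidef ∧ H ∈ K}) {η : ℝ} {M H : Mat d}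
    (h : IsPreconditioner 𝓗 η M H) {D : Mat d} (hDK : D ∈ K) (hD : Dᵀ = D) :
    matInner M (H⁻¹ * D * H⁻¹) = η ^ 2 * D.trace := by
  have hHK : H ∈ K := by have := h.mem; rw [hK] at this; exact this.2
  have hu := isUnit_det h.posDef
  have hev := eventually_posDef_add_smul h.posDef hD
  have key : ∀ᶠ s in 𝓝 (0 : ℝ), 0 ≤ s * (η ^ 2 * D.trace - matInner M (H⁻¹ * D * H⁻¹)) +
      s ^ 2 * matInner M (H⁻¹ * D * (H + s • D)⁻¹ * D * H⁻¹) := by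
    filter_upwards [hev] with s hs
    have h1 := h.le (H + s • D) (by
      rw [hK]; exact ⟨hs.posSemidef, K.add_mem hHK (K.smul_mem hDK s)⟩) hs
    rw [inv_add_smul_expansion s hu (isUnit_det hs), matInner_add_right, matInner_sub_right,
      matInner_smul_right, matInner_smul_right, Matrix.trace_add, Matrix.trace_smul,
      smul_eq_mul] at h1
    linarith
  have hc : ContinuousAt (fun s : ℝ => matInner M (H⁻¹ * D * (H + s • D)⁻¹ * D * H⁻¹)) 0 := by
    have hinv : ContinuousAt (fun s : ℝ => (H + s • D)⁻¹) 0 := by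
      simp only [Matrix.inv_def, Ring.inverse_eq_inv']
      have hdet : Continuous fun s : ℝ => (H + s • D).det := by fun_prop
      refine (hdet.continuousAt.inv₀ (by simpa using hu.ne_zero)).smul ?_
      fun_prop
    refine (continuous_matInner_right M).continuousAt.comp ?_
    have := ((continuousAt_const (y := H⁻¹ * D)).mul hinv |>.mul
      (continuousAt_const (y := D)) |>.mul (continuousAt_const (y := H⁻¹)))
    exact this
  linarith [eq_zero_of_eventually_nonneg hc key]

lemma IsPreconditioner.matInner_inv {𝓗 : Set (Mat d)} (h𝓗 : IsWellStructured 𝓗) {η : ℝ}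
    {M H : Mat d} (h : IsPreconditioner 𝓗 η M H) : matInner M H⁻¹ = η ^ 2 * H.trace := by
  obtain ⟨K, hK⟩ := h𝓗
  have hHK : H ∈ K := by have := h.mem; rw [hK] at this; exact this.2
  have := h.matInner_eq hK hHK (transpose_eq_of_posSemidef h.posDef.posSemidef)
  rwa [Matrix.nonsing_inv_mul _ (isUnit_det h.posDef), one_mul] at this

/-- Substituting `H D H`, which stays in `K`, for `D` removes the inverses: `M - η² H²` is
trace-orthogonal to the symmetric elements of `K`. Monotonicity, uniqueness and measurability of `H`
all start from this form. -/
lemma IsPreconditioner.matInner_left {𝓗 : Set (Mat d)} {K : Subalgebra ℝ (Mat d)}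
    (hK : 𝓗 = {H | H.PosSemidef ∧ H ∈ K}) {η : ℝ} {M H : Mat d}
    (h : IsPreconditioner 𝓗 η M H) {D : Mat d} (hDK : D ∈ K) (hD : Dᵀ = D) :
    matInner M D = η ^ 2 * (H * D * H).trace := by
  have hHK : H ∈ K := by have := h.mem; rw [hK] at this; exact this.2
  have hu := isUnit_det h.posDef
  have := h.matInner_eq hK (K.mul_mem (K.mul_mem hHK hDK) hHK) (by
    simp [hD, transpose_eq_of_posSemidef h.posDef.posSemidef, Matrix.mul_assoc])
  rwa [Matrix.mul_assoc H D, Matrix.nonsing_inv_mul_cancel_left _ _ hu, ← Matrix.mul_assoc,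
    Matrix.mul_nonsing_inv_cancel_right _ _ hu] at this

/-! ### Order comparison inside the algebra. -/

-- The negative part of `D`. The spectrum is finite, so functional calculus agrees with evaluating
-- an interpolation polynomial, which keeps the result in `K`.
open scoped MatrixOrder in
lemma exists_negPart {K : Subalgebra ℝ (Mat d)} {D : Mat d} (hDK : D ∈ K) (hD : Dᵀ = D) :
    ∃ E ∈ K, E.PosSemidef ∧ D * E = -(E * E) ∧ (D + E).PosSemidef := by
  have hsa : IsSelfAdjoint D := by simpa [IsSelfAdjoint, Matrix.star_eq_conjTranspose] using hD
  have hfin : (spectrum ℝ D).Finite := Matrix.finite_real_spectrum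
  set p := Lagrange.interpolate hfin.toFinset id (fun a : ℝ => max (-a) 0) with hp
  have hpe : Set.EqOn p.eval (fun a : ℝ => max (-a) 0) (spectrum ℝ D) := fun a ha =>
    Lagrange.eval_interpolate_at_node _ (Set.injOn_id _) (hfin.mem_toFinset.2 ha)
  refine ⟨Polynomial.aeval D p, ?_, ?_, ?_, ?_⟩
  · exact Algebra.adjoin_le (by simpa using hDK) (Polynomial.aeval_mem_adjoin_singleton ℝ D)
  all_goals rw [← cfc_polynomial p D hsa]
  · rw [cfc_congr hpe, ← Matrix.nonneg_iff_posSemidef]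
    exact cfc_nonneg fun a _ => le_max_right _ _
  · have h1 : D * cfc p.eval D = cfc (fun a : ℝ => a) D * cfc p.eval D := by
      rw [cfc_id' ℝ D hsa]
    rw [h1, ← cfc_mul (fun a : ℝ => a) p.eval D, ← cfc_mul p.eval p.eval D, ← cfc_neg]
    refine cfc_congr fun a ha => ?_
    simp only [hpe ha]
    rcases le_total a 0 with h | h
    · rw [max_eq_left (by linarith)]; ring
    · rw [max_eq_right (by linarith)]; ring
  · have h1 : D + cfc p.eval D = cfc (fun a : ℝ => a) D + cfc p.eval D := by
      rw [cfc_id' ℝ D hsa]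
    rw [h1, ← cfc_add D (fun a : ℝ => a) p.eval, ← Matrix.nonneg_iff_posSemidef]
    refine cfc_nonneg fun a ha => ?_
    have h2 : p.eval a = max (-a) 0 := hpe ha
    rw [h2]
    linarith [le_max_left (-a) 0]

/-- Comparison of two members of `𝓗` through their squares, tested against the positive
semidefinite elements of the algebra. -/
lemma posSemidef_sub_of_trace_le {K : Subalgebra ℝ (Mat d)} {A B : Mat d} (hA : A.PosDef)
    (hB : B.PosDef) (hAK : A ∈ K) (hBK : B ∈ K)
    (h : ∀ E ∈ K, E.PosSemidef → (B * E * B).trace ≤ (A * E * A).trace) :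
    (A - B).PosSemidef := by
  have hAt := transpose_eq_of_posSemidef hA.posSemidef
  have hBt := transpose_eq_of_posSemidef hB.posSemidef
  obtain ⟨E, hEK, hE, hDE, hP⟩ := exists_negPart (K.sub_mem hAK hBK) (by simp [hAt, hBt])
  have hEt := transpose_eq_of_posSemidef hE
  have hED : E * (A - B) = -(E * E) := by
    have := congrArg Matrix.transpose hDE
    simpa [hAt, hBt, hEt] using this
  have h1 := h E hEK hE
  -- With `E` the negative part of `A - B`, split `AEA - BEB = AE(A - B) + (A - B)EB` and use `(A -
  -- B)E = -E²`.
  have h2 : (A * E * A).trace - (B * E * B).trace = -((A + B) * (E * E)).trace := by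
    have e1 : (A * E * (A - B)).trace = -(A * (E * E)).trace := by
      rw [Matrix.mul_assoc, hED, Matrix.mul_neg, Matrix.trace_neg]
    have e2 : ((A - B) * E * B).trace = -(B * (E * E)).trace := by
      rw [hDE, Matrix.neg_mul, Matrix.trace_neg, Matrix.trace_mul_comm]
    rw [Matrix.mul_sub, Matrix.trace_sub] at e1
    rw [Matrix.sub_mul, Matrix.sub_mul, Matrix.trace_sub] at e2
    rw [Matrix.add_mul, Matrix.trace_add]
    linarith
  have h3 : (E * (A + B) * E).trace ≤ 0 := by
    rw [Matrix.trace_mul_cycle, Matrix.trace_mul_comm]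
    linarith
  have h4 : (E * (A + B) * E).PosSemidef := by
    have := (hA.add hB).posSemidef.mul_mul_conjTranspose_same E
    rwa [hE.isHermitian.eq] at this
  have h5 : E * (A + B) * E = 0 := h4.trace_eq_zero_iff.1 (le_antisymm h3 h4.trace_nonneg)
  -- `E(A + B)E = 0` with `A + B` positive definite leaves no vector with `Ev ≠ 0`.
  have h6 : E = 0 := by
    refine Matrix.mulVec_injective (funext fun v => ?_)
    rw [Matrix.zero_mulVec]
    by_contra hv
    have h7 := (hA.add hB).dotProduct_mulVec_pos hv
    rw [star_trivial, dotProduct_comm, dotProduct_mulVec_comm hEt, Matrix.mulVec_mulVec,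
      Matrix.mulVec_mulVec, h5] at h7
    simp at h7
  simpa [h6] using hP

lemma eq_of_trace_eq {K : Subalgebra ℝ (Mat d)} {A B : Mat d} (hA : A.PosDef)
    (hB : B.PosDef) (hAK : A ∈ K) (hBK : B ∈ K)
    (h : ∀ E ∈ K, Eᵀ = E → (B * E * B).trace = (A * E * A).trace) : A = B := by
  have h1 := posSemidef_sub_of_trace_le hA hB hAK hBK fun E hE hp =>
    (h E hE (transpose_eq_of_posSemidef hp)).le
  have h2 := posSemidef_sub_of_trace_le hB hA hBK hAK fun E hE hp =>
    (h E hE (transpose_eq_of_posSemidef hp)).ge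
  open scoped MatrixOrder in
  exact le_antisymm h2 h1

/-- Inversion is antitone on positive definite matrices. -/
lemma posSemidef_inv_sub_inv {P H : Mat d} (hP : P.PosDef) (hH : H.PosDef)
    (h : (H - P).PosSemidef) : (P⁻¹ - H⁻¹).PosSemidef := by
  have hPt := transpose_eq_of_posSemidef hP.posSemidef
  have hHt := transpose_eq_of_posSemidef hH.posSemidef
  have hPit := transpose_eq_of_posSemidef hP.posSemidef.inv
  have hHit := transpose_eq_of_posSemidef hH.posSemidef.inv
  refine posSemidef_of_quad_nonneg (by rw [Matrix.transpose_sub, hPit, hHit]) fun v => ?_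
  set u := H⁻¹ *ᵥ v with hu
  set w := P⁻¹ *ᵥ v with hw
  have hHu : H *ᵥ u = v := by
    rw [hu, Matrix.mulVec_mulVec, Matrix.mul_nonsing_inv _ (isUnit_det hH), Matrix.one_mulVec]
  have hPw : P *ᵥ w = v := by
    rw [hw, Matrix.mulVec_mulVec, Matrix.mul_nonsing_inv _ (isUnit_det hP), Matrix.one_mulVec]
  -- With `Hu = Pw = v`: `0 ≤ (u-w)ᵀP(u-w) = uᵀPu - 2uᵀv + wᵀv` and `uᵀPu ≤ uᵀHu = uᵀv`, hence `uᵀv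
  -- ≤ wᵀv`.
  have h1 := posSemidef_quad_nonneg hP.posSemidef (u - w)
  have h2 := posSemidef_quad_nonneg h u
  rw [Matrix.mulVec_sub, hPw, dotProduct_sub, sub_dotProduct, sub_dotProduct,
    dotProduct_mulVec_comm hPt w, hPw] at h1
  rw [Matrix.sub_mulVec, hHu, dotProduct_sub] at h2
  rw [Matrix.sub_mulVec, ← hu, ← hw, dotProduct_sub, dotProduct_comm v u, dotProduct_comm v w]
  linarith

/-! ### The norm of the domain -/

lemma matNorm_sq {H : Mat d} (hH : H.PosSemidef) (x : Vec d) :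
    matNorm H x ^ 2 = x.ofLp ⬝ᵥ H *ᵥ x.ofLp :=
  Real.sq_sqrt (posSemidef_quad_nonneg hH _)

lemma quad_le_trace_mul {H : Mat d} (hH : H.PosSemidef) (x : Vec d) :
    x.ofLp ⬝ᵥ H *ᵥ x.ofLp ≤ H.trace * ‖x‖ ^ 2 := by
  open scoped MatrixOrder in
  obtain ⟨C, rfl⟩ := CStarAlgebra.nonneg_iff_eq_star_mul_self.mp hH.nonneg
  have h1 : x.ofLp ⬝ᵥ (star C * C) *ᵥ x.ofLp = ∑ i, (∑ j, C i j * x.ofLp j) ^ 2 := by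
    rw [← Matrix.mulVec_mulVec, Matrix.dotProduct_mulVec, Matrix.star_eq_conjTranspose,
      Matrix.conjTranspose_eq_transpose_of_trivial, Matrix.vecMul_transpose]
    simp [dotProduct, Matrix.mulVec, pow_two]
  have h2 : (star C * C).trace = ∑ i, ∑ j, C i j ^ 2 := by
    rw [Matrix.trace, Finset.sum_comm]
    simp [Matrix.mul_apply, pow_two, Matrix.star_eq_conjTranspose]
  rw [h1, h2, Finset.sum_mul, EuclideanSpace.real_norm_sq_eq]
  exact Finset.sum_le_sum fun i _ => Finset.sum_mul_sq_le_sq_mul_sq _ _ _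

lemma matNorm_le_norm {𝓗 : Set (Mat d)} (h𝓗 : IsWellStructured 𝓗) (x : Vec d) :
    ∀ r ∈ {r | ∃ H ∈ 𝓗, H.trace ≤ 1 ∧ r = matNorm H x}, r ≤ ‖x‖ := by
  obtain ⟨K, rfl⟩ := h𝓗
  rintro _ ⟨H, hH, ht, rfl⟩
  refine Real.sqrt_le_iff.2 ⟨norm_nonneg _, (quad_le_trace_mul hH.1 x).trans ?_⟩
  nlinarith [sq_nonneg ‖x‖]

lemma setNorm_nonneg (𝓗 : Set (Mat d)) (x : Vec d) : 0 ≤ setNorm 𝓗 x :=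
  Real.sSup_nonneg (by rintro _ ⟨H, _, _, rfl⟩; exact Real.sqrt_nonneg _)

lemma domainNorm_nonneg (𝓗 : Set (Mat d)) (X : Set (Vec d)) : 0 ≤ domainNorm 𝓗 X :=
  Real.sSup_nonneg (by rintro _ ⟨x, _, rfl⟩; exact setNorm_nonneg _ _)

/-- By homogeneity, normalize `H` to trace one. Boundedness of `X` ensures that both `sSup` are
genuine suprema rather than the default value. -/
lemma quad_le_trace_mul_domainNorm {𝓗 : Set (Mat d)} (h𝓗 : IsWellStructured 𝓗) {X : Set (Vec d)}
    (hX : Bornology.IsBounded X) {x : Vec d} (hx : x ∈ X) {H : Mat d} (hH : H ∈ 𝓗) :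
    x.ofLp ⬝ᵥ H *ᵥ x.ofLp ≤ H.trace * domainNorm 𝓗 X ^ 2 := by
  have hps : H.PosSemidef := by obtain ⟨K, rfl⟩ := h𝓗; exact hH.1
  rcases hps.trace_nonneg.eq_or_lt with ht | ht
  · rw [(hps.trace_eq_zero_iff).1 ht.symm]; simp
  have hmem : H.trace⁻¹ • H ∈ 𝓗 := by
    obtain ⟨K, rfl⟩ := h𝓗
    exact ⟨hH.1.smul (by positivity), K.smul_mem hH.2 _⟩
  have h1 : matNorm (H.trace⁻¹ • H) x ≤ setNorm 𝓗 x :=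
    le_csSup ⟨_, matNorm_le_norm h𝓗 x⟩ ⟨_, hmem, by simp [ht.ne'], rfl⟩
  have h2 : setNorm 𝓗 x ≤ domainNorm 𝓗 X := by
    obtain ⟨C, hC⟩ := hX.exists_norm_le
    refine le_csSup ⟨C, ?_⟩ ⟨x, hx, rfl⟩
    rintro _ ⟨y, hy, rfl⟩
    exact (Real.sSup_le (matNorm_le_norm h𝓗 y) (norm_nonneg _)).trans (hC y hy)
  have h3 := pow_le_pow_left₀ (Real.sqrt_nonneg _) (h1.trans h2) 2
  change matNorm (H.trace⁻¹ • H) x ^ 2 ≤ _ at h3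
  rw [matNorm_sq (hps.smul (by positivity)), Matrix.smul_mulVec, dotProduct_smul, smul_eq_mul,
    inv_mul_le_iff₀ ht] at h3
  exact h3

/-- The parallelogram identity; its factor `2` for each of the two points gives the `4`. -/
lemma quad_sub_le {𝓗 : Set (Mat d)} (h𝓗 : IsWellStructured 𝓗) {X : Set (Vec d)}
    (hX : Bornology.IsBounded X) {x y : Vec d} (hx : x ∈ X) (hy : y ∈ X) {H : Mat d}
    (hH : H ∈ 𝓗) :
    (x - y).ofLp ⬝ᵥ H *ᵥ (x - y).ofLp ≤ 4 * domainNorm 𝓗 X ^ 2 * H.trace := by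
  have hps : H.PosSemidef := by obtain ⟨K, rfl⟩ := h𝓗; exact hH.1
  have h1 := quad_le_trace_mul_domainNorm h𝓗 hX hx hH
  have h2 := quad_le_trace_mul_domainNorm h𝓗 hX hy hH
  have h3 := posSemidef_quad_nonneg hps (x + y).ofLp
  have h4 : (x - y).ofLp ⬝ᵥ H *ᵥ (x - y).ofLp + (x + y).ofLp ⬝ᵥ H *ᵥ (x + y).ofLp =
      2 * (x.ofLp ⬝ᵥ H *ᵥ x.ofLp) + 2 * (y.ofLp ⬝ᵥ H *ᵥ y.ofLp) := by
    simp only [WithLp.ofLp_sub, WithLp.ofLp_add, Matrix.mulVec_sub, Matrix.mulVec_add,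
      dotProduct_sub, dotProduct_add, sub_dotProduct, add_dotProduct]
    ring
  linarith

/-! ### Projections and one step of the method. -/

lemma quad_sub {A : Mat d} (hA : Aᵀ = A) (u v : Fin d → ℝ) :
    (u - v) ⬝ᵥ A *ᵥ (u - v) = u ⬝ᵥ A *ᵥ u - 2 * (u ⬝ᵥ A *ᵥ v) + v ⬝ᵥ A *ᵥ v := by
  rw [Matrix.mulVec_sub, dotProduct_sub, sub_dotProduct, sub_dotProduct,
    dotProduct_mulVec_comm hA v u]
  ring

lemma quad_smul (A : Mat d) (c : ℝ) (v : Fin d → ℝ) :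
    (c • v) ⬝ᵥ A *ᵥ (c • v) = c ^ 2 * (v ⬝ᵥ A *ᵥ v) := by
  rw [Matrix.mulVec_smul, dotProduct_smul, smul_dotProduct]
  simp only [smul_eq_mul]; ring

/-- Variational inequality for the projection. -/
lemma IsProjection.dotProduct_le_zero {X : Set (Vec d)} (hX : Convex ℝ X) {H : Mat d}
    (hH : H.PosSemidef) {y z : Vec d} (h : IsProjection X H y z) {u : Vec d} (hu : u ∈ X) :
    (y - z).ofLp ⬝ᵥ H *ᵥ (u - z).ofLp ≤ 0 := by
  have hHt := transpose_eq_of_posSemidef hH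
  set b := (y - z).ofLp ⬝ᵥ H *ᵥ (u - z).ofLp with hb
  set c := (u - z).ofLp ⬝ᵥ H *ᵥ (u - z).ofLp with hc
  have hc0 : 0 ≤ c := posSemidef_quad_nonneg hH _
  have key : ∀ s : ℝ, 0 < s → s ≤ 1 → 2 * b ≤ s * c := by
    intro s hs hs1
    have hmem : z + s • (u - z) ∈ X := hX.add_smul_sub_mem h.mem hu ⟨hs.le, hs1⟩
    have h1 := pow_le_pow_left₀ (Real.sqrt_nonneg _) (h.le _ hmem) 2
    change matNorm H _ ^ 2 ≤ matNorm H _ ^ 2 at h1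
    rw [matNorm_sq hH, matNorm_sq hH] at h1
    have h2 : (y - (z + s • (u - z))).ofLp = (y - z).ofLp - s • (u - z).ofLp := by
      ext i; simp; ring
    rw [h2, quad_sub hHt, quad_smul, Matrix.mulVec_smul, dotProduct_smul, smul_eq_mul, ← hb,
      ← hc] at h1
    have h3 : 0 ≤ s * (s * c - 2 * b) := by linarith
    linarith [(mul_nonneg_iff_of_pos_left hs).1 h3]
  by_contra! hpos
  -- If `b > 0`, this step size gives `s c ≤ b`, contradicting `2 b ≤ s c`; the `+ 1` covers `c =
  -- 0`.
  have h1 := key (min 1 (b / (c + 1))) (lt_min one_pos (by positivity)) (min_le_left _ _)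
  have h2 : min 1 (b / (c + 1)) * c ≤ b / (c + 1) * c :=
    mul_le_mul_of_nonneg_right (min_le_right _ _) hc0
  have h3 : b / (c + 1) * c ≤ b := by
    rw [div_mul_eq_mul_div, div_le_iff₀ (by linarith)]; nlinarith
  linarith

lemma IsProjection.quad_le {X : Set (Vec d)} (hX : Convex ℝ X) {H : Mat d}
    (hH : H.PosSemidef) {y z : Vec d} (h : IsProjection X H y z) {u : Vec d} (hu : u ∈ X) :
    (z - u).ofLp ⬝ᵥ H *ᵥ (z - u).ofLp ≤ (y - u).ofLp ⬝ᵥ H *ᵥ (y - u).ofLp := by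
  have hHt := transpose_eq_of_posSemidef hH
  have h1 := h.dotProduct_le_zero hX hH hu
  have h2 := posSemidef_quad_nonneg hH (y - z).ofLp
  have e1 : (y - u).ofLp = (y - z).ofLp - (u - z).ofLp := by
    ext i; simp
  have e2 : (z - u).ofLp = (-1 : ℝ) • (u - z).ofLp := by
    ext i; simp
  rw [e1, e2, quad_smul, quad_sub hHt]
  linarith

/-- Projecting does not increase the `H`-distance to `u ∈ X`; then the square of `(x - u) - H⁻¹g` is
expanded. -/
lemma step_inequality {X : Set (Vec d)} (hX : Convex ℝ X) {H : Mat d} (hH : H.PosDef)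
    {x z : Vec d} {g : Fin d → ℝ} (h : IsProjection X H (x - WithLp.toLp 2 (H⁻¹ *ᵥ g)) z)
    {u : Vec d} (hu : u ∈ X) :
    2 * (g ⬝ᵥ (x - u).ofLp) + (z - u).ofLp ⬝ᵥ H *ᵥ (z - u).ofLp ≤
      (x - u).ofLp ⬝ᵥ H *ᵥ (x - u).ofLp + g ⬝ᵥ H⁻¹ *ᵥ g := by
  have hHt := transpose_eq_of_posSemidef hH.posSemidef
  have h1 := h.quad_le hX hH.posSemidef hu
  have e1 : (x - WithLp.toLp 2 (H⁻¹ *ᵥ g) - u).ofLp = (x - u).ofLp - H⁻¹ *ᵥ g := by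
    simp only [WithLp.ofLp_sub]; abel
  have e2 : H *ᵥ (H⁻¹ *ᵥ g) = g := by
    rw [Matrix.mulVec_mulVec, Matrix.mul_nonsing_inv _ (isUnit_det hH), Matrix.one_mulVec]
  rw [e1, quad_sub hHt, e2, dotProduct_comm _ g, dotProduct_comm _ g] at h1
  linarith

/-! ### Scaling, monotonicity and the regret bound. -/

lemma inv_smul_of_posDef {w : ℝ} (hw : w ≠ 0) {H : Mat d} (hH : H.PosDef) :
    (w • H)⁻¹ = w⁻¹ • H⁻¹ :=
  Matrix.inv_smul' H (Units.mk0 w hw) (isUnit_det hH)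

lemma smul_mem_of_isWellStructured {𝓗 : Set (Mat d)} (h𝓗 : IsWellStructured 𝓗) {w : ℝ}
    (hw : 0 ≤ w) {H : Mat d} (hH : H ∈ 𝓗) : w • H ∈ 𝓗 := by
  obtain ⟨K, rfl⟩ := h𝓗
  exact ⟨hH.1.smul hw, K.smul_mem hH.2 _⟩

lemma add_mem_of_isWellStructured {𝓗 : Set (Mat d)} (h𝓗 : IsWellStructured 𝓗)
    {A B : Mat d} (hA : A ∈ 𝓗) (hB : B ∈ 𝓗) : A + B ∈ 𝓗 := by
  obtain ⟨K, rfl⟩ := h𝓗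
  exact ⟨hA.1.add hB.1, K.add_mem hA.2 hB.2⟩

lemma one_mem_of_isWellStructured {𝓗 : Set (Mat d)} (h𝓗 : IsWellStructured 𝓗) : 1 ∈ 𝓗 := by
  obtain ⟨K, rfl⟩ := h𝓗
  exact ⟨.one, K.one_mem⟩

/-- The objective for `w² M` at `w H` is `w` times the objective for `M` at `H`. -/
lemma IsPreconditioner.smul {𝓗 : Set (Mat d)} (h𝓗 : IsWellStructured 𝓗) {η : ℝ} {M H : Mat d}
    (h : IsPreconditioner 𝓗 η M H) {w : ℝ} (hw : 0 < w) :
    IsPreconditioner 𝓗 η (w ^ 2 • M) (w • H) where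
  mem := smul_mem_of_isWellStructured h𝓗 hw.le h.mem
  posDef := h.posDef.smul hw
  le H' hH' hp := by
    have h1 := h.le (w⁻¹ • H') (smul_mem_of_isWellStructured h𝓗 (by positivity) hH')
      (hp.smul (by positivity))
    rw [inv_smul_of_posDef (by positivity) hp, inv_inv] at h1
    rw [inv_smul_of_posDef hw.ne' h.posDef]
    simp only [matInner_smul_left, matInner_smul_right, Matrix.trace_smul, smul_eq_mul] at h1 ⊢
    have h2 := mul_le_mul_of_nonneg_left h1 hw.le
    have e1 : w⁻¹ * (w ^ 2 * matInner M H⁻¹) = w * matInner M H⁻¹ := by field_simp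
    have e2 : w * (η ^ 2 * (w⁻¹ * H'.trace)) = η ^ 2 * H'.trace := by field_simp
    rw [e1]
    nlinarith [h2, e2]

/-- The preconditioner is monotone in the accumulator. -/
lemma IsPreconditioner.mono {𝓗 : Set (Mat d)} (h𝓗 : IsWellStructured 𝓗) {η : ℝ} (hη : η ≠ 0)
    {M M' H H' : Mat d} (h : IsPreconditioner 𝓗 η M H) (h' : IsPreconditioner 𝓗 η M' H')
    (hM : (M' - M).PosSemidef) : H' - H ∈ 𝓗 := by
  obtain ⟨K, hK⟩ := h𝓗
  have hHK : H.PosSemidef ∧ H ∈ K := by have := h.mem; rwa [hK] at this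
  have hHK' : H'.PosSemidef ∧ H' ∈ K := by have := h'.mem; rwa [hK] at this
  rw [hK]
  refine ⟨posSemidef_sub_of_trace_le h'.posDef h.posDef hHK'.2 hHK.2 fun E hE hp => ?_,
    K.sub_mem hHK'.2 hHK.2⟩
  have hEt := transpose_eq_of_posSemidef hp
  have h1 := h.matInner_left hK hE hEt
  have h2 := h'.matInner_left hK hE hEt
  have h3 := matInner_nonneg hM hp
  rw [matInner_sub_left, h1, h2, ← mul_sub] at h3
  have := (mul_nonneg_iff_of_pos_left (by positivity)).1 h3
  linarith

/-- Regret bound for adaptive regularization with accumulators `A` and preconditioners `P`. -/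
lemma regret_bound {𝓗 : Set (Mat d)} (h𝓗 : IsWellStructured 𝓗) {X : Set (Vec d)}
    (hXb : Bornology.IsBounded X) {T : ℕ} (hT : 1 ≤ T)
    (hη : √2 * domainNorm 𝓗 X ≠ 0) (A P : ℕ → Mat d) (x : ℕ → Vec d) (c : ℕ → Fin d → ℝ)
    (hA0 : (A 0).PosSemidef) (hx : ∀ t ∈ Finset.Icc 1 T, x t ∈ X)
    (hA : ∀ t ∈ Finset.Icc 1 T, A t = A (t - 1) + Matrix.vecMulVec (c t) (c t))
    (hP : ∀ t ∈ Finset.Icc 1 T, IsPreconditioner 𝓗 (√2 * domainNorm 𝓗 X) (A t) (P t))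
    {u : Vec d} (hu : u ∈ X)
    (hstep : ∀ t ∈ Finset.Icc 1 T,
      2 * (c t ⬝ᵥ (x t - u).ofLp) + (x (t + 1) - u).ofLp ⬝ᵥ P t *ᵥ (x (t + 1) - u).ofLp ≤
        (x t - u).ofLp ⬝ᵥ P t *ᵥ (x t - u).ofLp + c t ⬝ᵥ (P t)⁻¹ *ᵥ c t)
    {Q : Mat d} (hQ : Q ∈ 𝓗) (hQp : Q.PosDef) :
    ∑ t ∈ Finset.Icc 1 T, c t ⬝ᵥ (x t - u).ofLp ≤
      matInner (A T) Q⁻¹ + 2 * domainNorm 𝓗 X ^ 2 * Q.trace := by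
  set R := domainNorm 𝓗 X with hR
  have hη2 : (√2 * R) ^ 2 = 2 * R ^ 2 := by rw [mul_pow]; norm_num
  -- The invariant: `4R² Tr P` pays for the changes of metric, and the parenthesis is the objective
  -- minimized by `P`, which pays for the terms `cᵀP⁻¹c`.
  have key : ∀ n, n + 1 ≤ T →
      2 * ∑ t ∈ Finset.Icc 1 (n + 1), c t ⬝ᵥ (x t - u).ofLp +
        (x (n + 2) - u).ofLp ⬝ᵥ P (n + 1) *ᵥ (x (n + 2) - u).ofLp ≤
      4 * R ^ 2 * (P (n + 1)).trace + (matInner (A (n + 1)) (P (n + 1))⁻¹ +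
        2 * R ^ 2 * (P (n + 1)).trace) := by
    intro n
    induction n with
    | zero =>
      intro h1
      have hm : 1 ∈ Finset.Icc 1 T := by simp [hT]
      have h2 := hstep 1 hm
      have h3 := quad_sub_le h𝓗 hXb (hx 1 hm) hu (hP 1 hm).mem
      have h4 := matInner_nonneg hA0 (hP 1 hm).posDef.posSemidef.inv
      have h5 := (hP 1 hm).posDef.posSemidef.trace_nonneg
      have h6 := mul_nonneg (sq_nonneg R) h5
      have h7 : A 1 = A 0 + _ := hA 1 hm
      simp only [zero_add, Finset.Icc_self, Finset.sum_singleton]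
      rw [h7, matInner_add_left, matInner_vecMulVec]
      change _ + (x 2 - u).ofLp ⬝ᵥ P 1 *ᵥ (x 2 - u).ofLp ≤ _ at h2
      linarith
    | succ n ih =>
      intro h1
      have ih := ih (by omega)
      have hm : n + 2 ∈ Finset.Icc 1 T := by simp; omega
      have hm' : n + 1 ∈ Finset.Icc 1 T := by simp; omega
      have h2 : 2 * (c (n + 2) ⬝ᵥ (x (n + 2) - u).ofLp) +
          (x (n + 3) - u).ofLp ⬝ᵥ P (n + 2) *ᵥ (x (n + 3) - u).ofLp ≤ _ := hstep (n + 2) hm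
      have h7 : A (n + 2) = A (n + 1) + _ := hA (n + 2) hm
      -- The increment of `P` lies in `𝓗`, so changing the metric costs `4R²` times an increment of
      -- the trace, which telescopes.
      have hmono := (hP _ hm').mono h𝓗 hη (hP _ hm) (by
        rw [h7, add_sub_cancel_left]; exact posSemidef_vecMulVec _)
      have h3 := quad_sub_le h𝓗 hXb (hx _ hm) hu hmono
      -- Be-the-leader: the earlier preconditioner is at least as good as the later one for the
      -- earlier accumulator.
      have h8 := (hP _ hm').le _ (hP _ hm).mem (hP _ hm).posDef
      rw [hη2] at h8
      rw [← hR, Matrix.sub_mulVec, dotProduct_sub, Matrix.trace_sub] at h3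
      rw [Finset.sum_Icc_succ_top (by omega)]
      change 2 * (_ + c (n + 2) ⬝ᵥ (x (n + 2) - u).ofLp) +
        (x (n + 3) - u).ofLp ⬝ᵥ P (n + 2) *ᵥ (x (n + 3) - u).ofLp ≤
        4 * R ^ 2 * (P (n + 2)).trace + (matInner (A (n + 2)) (P (n + 2))⁻¹ +
          2 * R ^ 2 * (P (n + 2)).trace)
      rw [h7, matInner_add_left, matInner_vecMulVec]
      linarith
  obtain ⟨n, rfl⟩ : ∃ n, T = n + 1 := ⟨T - 1, by omega⟩
  have hm : n + 1 ∈ Finset.Icc 1 (n + 1) := by simp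
  have h1 := key n le_rfl
  have h2 := posSemidef_quad_nonneg (hP _ hm).posDef.posSemidef (x (n + 2) - u).ofLp
  -- At the optimum both terms of the objective equal `2R² Tr P`. Hence twice the regret is at most
  -- `8R² Tr P`, which is twice the minimal value.
  have h3 := (hP _ hm).matInner_inv h𝓗
  have h4 := (hP _ hm).le Q hQ hQp
  rw [hη2] at h3 h4
  linarith

/-! ### The weighted run as a rescaled unweighted run. -/

lemma accum_eq_sum {T : ℕ} {𝓗 : Set (Mat d)} {X : Set (Vec d)} {ε η β : ℝ} (hβ : 0 < β)
    {x₁ : Vec d} {ℓ : ℕ → Vec d → ℝ} {x : ℕ → Vec d} {M H : ℕ → Mat d}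
    (h : IsWeightedRun T 𝓗 X ε η β x₁ ℓ x M H) {n : ℕ} (hn : n ≤ T) :
    M n = (β ^ (n : ℝ) * ε) • (1 : Mat d) + ∑ t ∈ Finset.Icc 1 n, β ^ ((n : ℝ) - t) •
      Matrix.vecMulVec (gradient (ℓ t) (x t)).ofLp (gradient (ℓ t) (x t)).ofLp := by
  induction n with
  | zero => simp [h.accum_zero]
  | succ n ih =>
    rw [h.accum_step (n + 1) (by simp; omega), Finset.sum_Icc_succ_top (by omega),
      Nat.add_sub_cancel, ih (by omega), smul_add, smul_smul, Finset.smul_sum, add_assoc]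
    congr 1
    · congr 1
      push_cast
      rw [Real.rpow_add_one hβ.ne']; ring
    · congr 1
      · refine Finset.sum_congr rfl fun t _ => ?_
        rw [smul_smul]
        congr 1
        push_cast
        rw [add_sub_right_comm, Real.rpow_add_one hβ.ne', mul_comm]
      · simp

lemma IsWeightedRun.mem {T : ℕ} {𝓗 : Set (Mat d)} {X : Set (Vec d)} {ε η β : ℝ}
    {x₁ : Vec d} {ℓ : ℕ → Vec d → ℝ} {x : ℕ → Vec d} {M H : ℕ → Mat d}
    (h : IsWeightedRun T 𝓗 X ε η β x₁ ℓ x M H) (hx₁ : x₁ ∈ X) {t : ℕ}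
    (ht : t ∈ Finset.Icc 1 T) : x t ∈ X := by
  rw [Finset.mem_Icc] at ht
  rcases eq_or_lt_of_le ht.1 with rfl | h1
  · rw [h.init]; exact hx₁
  · have := (h.step (t - 1) (by simp; omega)).mem
    rwa [Nat.sub_add_cancel ht.1] at this

lemma posSemidef_accum {T : ℕ} {𝓗 : Set (Mat d)} {X : Set (Vec d)} {ε η β : ℝ} (hβ : 0 < β)
    {x₁ : Vec d} {ℓ : ℕ → Vec d → ℝ} {x : ℕ → Vec d} {M H : ℕ → Mat d}
    (h : IsWeightedRun T 𝓗 X ε η β x₁ ℓ x M H) {n : ℕ} (hn : n ≤ T) :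
    (M n - (β ^ (n : ℝ) * ε) • (1 : Mat d)).PosSemidef := by
  rw [accum_eq_sum hβ h hn, add_sub_cancel_left]
  exact Matrix.posSemidef_sum _ fun t _ =>
    (posSemidef_vecMulVec _).smul (by positivity)

/-- If `η = 0`, the optimality condition at `D = 1` would give `Tr M_1 = 0`, whereas `M_1 ≽ βεI`. -/
lemma IsWeightedRun.eta_ne_zero {T : ℕ} (hT : 1 ≤ T) {𝓗 : Set (Mat d)}
    (h𝓗 : IsWellStructured 𝓗) {X : Set (Vec d)} {ε η β : ℝ} (hε : 0 < ε) (hβ : 0 < β)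
    {x₁ : Vec d} {ℓ : ℕ → Vec d → ℝ} {x : ℕ → Vec d} {M H : ℕ → Mat d}
    (h : IsWeightedRun T 𝓗 X ε η β x₁ ℓ x M H) (hd : d ≠ 0) : η ≠ 0 := by
  rintro rfl
  obtain ⟨K, hK⟩ := h𝓗
  have h1 := (h.precond 1 (by simp [hT])).matInner_left hK K.one_mem (by simp)
  have h2 := matInner_nonneg (posSemidef_accum hβ h hT) (Matrix.PosSemidef.one (n := Fin d))
  rw [matInner_sub_left, h1, matInner_smul_left, matInner_one_left, Matrix.trace_one] at h2
  have h3 : 0 < β ^ ((1 : ℕ) : ℝ) * ε * (Fintype.card (Fin d) : ℝ) := by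
    have : 0 < d := Nat.pos_of_ne_zero hd
    simp only [Fintype.card_fin]
    positivity
  simp only [ne_eq, OfNat.ofNat_ne_zero, not_false_eq_true, zero_pow, zero_mul] at h2
  linarith

/-- Regret bound for the weighted algorithm. -/
lemma IsWeightedRun.regret_le {T : ℕ} (hT : 1 ≤ T) {𝓗 : Set (Mat d)}
    (h𝓗 : IsWellStructured 𝓗) {X : Set (Vec d)} (hX : Convex ℝ X)
    (hXb : Bornology.IsBounded X) {ε β : ℝ} (hε : 0 < ε) (hβ : 0 < β)
    {x₁ : Vec d} (hx₁ : x₁ ∈ X) {ℓ : ℕ → Vec d → ℝ} {x : ℕ → Vec d} {M H : ℕ → Mat d}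
    (h : IsWeightedRun T 𝓗 X ε (√2 * domainNorm 𝓗 X) β x₁ ℓ x M H)
    {u : Vec d} (hu : u ∈ X) {Q : Mat d} (hQ : Q ∈ 𝓗) (hQp : Q.PosDef) :
    ∑ t ∈ Finset.Icc 1 T, β ^ (((T : ℝ) - t) / 2) *
        ((gradient (ℓ t) (x t)).ofLp ⬝ᵥ (x t - u).ofLp) ≤
      matInner (M T) Q⁻¹ + 2 * domainNorm 𝓗 X ^ 2 * Q.trace := by
  rcases Nat.eq_zero_or_pos d with rfl | hd
  -- In dimension zero `η` may vanish, but every term of the bound is zero.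
  · simp [matInner, Matrix.trace, dotProduct]
  have hw : ∀ t : ℕ, 0 < β ^ (((T : ℝ) - t) / 2) := fun t => by positivity
  have hw2 : ∀ t : ℕ, (β ^ (((T : ℝ) - t) / 2)) ^ 2 = β ^ ((T : ℝ) - t) := fun t => by
    rw [← Real.rpow_natCast, ← Real.rpow_mul hβ.le]; congr 1; push_cast; ring
  -- The weight of `M_t` is `β^(T-t)`, which turns the discounted recursion into a plain sum of the
  -- outer products of `w_t g_t`.
  have key := regret_bound h𝓗 hXb hT (h.eta_ne_zero hT h𝓗 hε hβ hd.ne')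
    (fun t => (β ^ (((T : ℝ) - t) / 2)) ^ 2 • M t) (fun t => β ^ (((T : ℝ) - t) / 2) • H t) x
    (fun t => β ^ (((T : ℝ) - t) / 2) • (gradient (ℓ t) (x t)).ofLp)
    (by
      rw [h.accum_zero]
      exact (Matrix.PosSemidef.one.smul hε.le).smul (by positivity))
    (fun t ht => h.mem hx₁ ht) ?_ (fun t ht => (h.precond t ht).smul h𝓗 (hw t)) hu ?_ hQ hQp
  · simpa only [smul_dotProduct, smul_eq_mul, sub_self, zero_div, Real.rpow_zero, one_pow,
      one_smul] using key
  · intro t ht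
    simp only []
    rw [h.accum_step t ht, hw2, hw2, smul_add, smul_smul, Matrix.vecMulVec_smul,
      Matrix.smul_vecMulVec, smul_smul, ← pow_two, hw2]
    congr 2
    rw [Nat.cast_sub (Finset.mem_Icc.1 ht).1, ← Real.rpow_add_one hβ.ne']
    congr 1; push_cast; ring
  · intro t ht
    have h1 := step_inequality hX (h.precond t ht).posDef (h.step t ht) hu
    have h2 := mul_le_mul_of_nonneg_left h1 (hw t).le
    simp only []
    rw [inv_smul_of_posDef (hw t).ne' (h.precond t ht).posDef]
    simp only [smul_dotProduct, Matrix.smul_mulVec, dotProduct_smul, Matrix.mulVec_smul,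
      smul_eq_mul]
    rw [inv_mul_cancel_left₀ (hw t).ne']
    linarith

/-! ### Smooth functions: quadratic upper bound and gradient domination. -/

lemma fderiv_apply_eq (f : Vec d → ℝ) (x v : Vec d) :
    fderiv ℝ f x v = (gradient f x).ofLp ⬝ᵥ v.ofLp := by
  have h : fderiv ℝ f x v = inner ℝ (gradient f x) v := by
    rw [gradient, InnerProductSpace.toDual_symm_apply]
  rw [h, EuclideanSpace.inner_eq_star_dotProduct, star_trivial, dotProduct_comm]

lemma quad_hessian (L : Vec d → ℝ) (x v : Vec d) :
    fderiv ℝ (fderiv ℝ L) x v v = v.ofLp ⬝ᵥ hessian L x *ᵥ v.ofLp := by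
  have hv : v = ∑ i, v.ofLp i • EuclideanSpace.single i (1 : ℝ) := by
    ext j; simp [Finset.sum_apply, Pi.single_apply]
  conv_lhs => rw [hv]
  simp only [map_sum, map_smul, _root_.sum_apply, _root_.smul_apply,
    smul_eq_mul, dotProduct, Matrix.mulVec, hessian, Matrix.of_apply, Finset.mul_sum]
  rw [Finset.sum_comm]
  refine Finset.sum_congr rfl fun i _ => Finset.sum_congr rfl fun j _ => ?_
  ring

/-- Second-order upper bound in one variable. -/
lemma le_quadratic_of_deriv_le {f f' f'' : ℝ → ℝ} {c : ℝ} (hf : ∀ s, HasDerivAt f (f' s) s)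
    (hf' : ∀ s, HasDerivAt f' (f'' s) s) (hc : ∀ s, f'' s ≤ c) :
    f 1 ≤ f 0 + f' 0 + c / 2 := by
  have hd1 : ∀ s, HasDerivAt (fun s => f' s - f' 0 - s * c) (f'' s - c) s := fun s => by
    have h := ((hf' s).sub_const (f' 0)).sub ((hasDerivAt_id s).mul_const c)
    rw [one_mul] at h
    exact h
  have ha1 : Antitone fun s => f' s - f' 0 - s * c :=
    antitone_of_deriv_nonpos (fun s => (hd1 s).differentiableAt) fun s => by
      rw [(hd1 s).deriv]; linarith [hc s]
  have hd2 : ∀ s, HasDerivAt (fun s => f s - s * f' 0 - s ^ 2 * (c / 2))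
      (f' s - f' 0 - s * c) s := fun s => by
    have h := ((hf s).sub ((hasDerivAt_id s).mul_const (f' 0))).sub
      ((hasDerivAt_pow 2 s).mul_const (c / 2))
    refine h.congr_deriv ?_
    norm_num; ring
  have ha2 : AntitoneOn (fun s => f s - s * f' 0 - s ^ 2 * (c / 2)) (Set.Ici 0) := by
    refine antitoneOn_of_deriv_nonpos (convex_Ici 0)
      (fun s _ => (hd2 s).continuousAt.continuousWithinAt)
      (fun s _ => (hd2 s).differentiableAt.differentiableWithinAt) fun s hs => ?_
    rw [interior_Ici] at hs
    rw [(hd2 s).deriv]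
    simpa using ha1 (le_of_lt hs)
  have := ha2 (by simp) (by simp) zero_le_one
  simp at this
  linarith

lemma HessianBoundedBy.le_quadratic {L : Vec d → ℝ} {H : Mat d} (h : HessianBoundedBy L H)
    (x v : Vec d) :
    L (x + v) ≤ L x + (gradient L x).ofLp ⬝ᵥ v.ofLp + (v.ofLp ⬝ᵥ H *ᵥ v.ofLp) / 2 := by
  have hl : ∀ s : ℝ, HasDerivAt (fun s : ℝ => x + s • v) v s := fun s => by
    simpa using ((hasDerivAt_id s).smul_const v).const_add x
  have h1 : ∀ s : ℝ, HasDerivAt (fun s : ℝ => L (x + s • v)) (fderiv ℝ L (x + s • v) v) s :=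
    fun s => (h.differentiable (x + s • v)).hasFDerivAt.comp_hasDerivAt s (hl s)
  have h2 : ∀ s : ℝ, HasDerivAt (fun s : ℝ => fderiv ℝ L (x + s • v) v)
      (fderiv ℝ (fderiv ℝ L) (x + s • v) v v) s := fun s => by
    have := (h.differentiable_fderiv (x + s • v)).hasFDerivAt.comp_hasDerivAt s (hl s)
    simpa using this.clm_apply (hasDerivAt_const s v)
  have h3 := le_quadratic_of_deriv_le h1 h2 (c := v.ofLp ⬝ᵥ H *ᵥ v.ofLp) fun s => by
    rw [quad_hessian]
    have := posSemidef_quad_nonneg (h.upper (x + s • v)) v.ofLp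
    rw [Matrix.sub_mulVec, dotProduct_sub] at this
    linarith
  simpa [fderiv_apply_eq L] using h3

lemma HessianBoundedBy.mono {L : Vec d → ℝ} {H P : Mat d} (h : HessianBoundedBy L H)
    (hP : (P - H).PosSemidef) : HessianBoundedBy L P where
  differentiable := h.differentiable
  differentiable_fderiv := h.differentiable_fderiv
  upper x := by simpa using hP.add (h.upper x)
  lower x := by
    have := hP.add (h.lower x)
    rwa [show P - H + (hessian L x - -H) = hessian L x - -P by abel] at this

/-- For a smooth function, the gradient is dominated by the suboptimality. -/
lemma HessianBoundedBy.quad_gradient_le {L : Vec d → ℝ} {P : Mat d} (h : HessianBoundedBy L P)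
    (hP : P.PosDef) {xs : Vec d} (hmin : ∀ y, L xs ≤ L y) (x : Vec d) :
    (gradient L x).ofLp ⬝ᵥ P⁻¹ *ᵥ (gradient L x).ofLp ≤ 2 * (L x - L xs) := by
  set g := (gradient L x).ofLp with hg
  -- The displacement `-P⁻¹g` minimizes the quadratic upper bound, lowering it by `gᵀP⁻¹g / 2`.
  have h1 := h.le_quadratic x (WithLp.toLp 2 (-(P⁻¹ *ᵥ g)))
  have h2 := hmin (x + WithLp.toLp 2 (-(P⁻¹ *ᵥ g)))
  have e2 : P *ᵥ (P⁻¹ *ᵥ g) = g := by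
    rw [Matrix.mulVec_mulVec, Matrix.mul_nonsing_inv _ (isUnit_det hP), Matrix.one_mulVec]
  simp only [Matrix.mulVec_neg, dotProduct_neg, neg_dotProduct, e2, neg_neg, ← hg] at h1
  rw [dotProduct_comm (P⁻¹ *ᵥ g)] at h1
  linarith

lemma continuous_gradient {L : Vec d → ℝ} (h : Differentiable ℝ (fderiv ℝ L)) :
    Continuous (gradient L) :=
  (InnerProductSpace.toDual ℝ (Vec d)).symm.continuous.comp h.continuous

/-! ### Measurability of the iterates. -/

instance : MeasurableSpace (Mat d) := inferInstanceAs (MeasurableSpace (Fin d → Fin d → ℝ))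
instance : BorelSpace (Mat d) := inferInstanceAs (BorelSpace (Fin d → Fin d → ℝ))
instance : PolishSpace (Mat d) := inferInstanceAs (PolishSpace (Fin d → Fin d → ℝ))

/-- Measurability of a selection from a measurable set of pairs in which the second component is
determined by the first. -/
lemma measurable_of_graph {Ω α β : Type*} [MeasurableSpace Ω] [MeasurableSpace α]
    [StandardBorelSpace α] [MeasurableSpace β] [StandardBorelSpace β] {G : Set (α × β)}
    (hG : MeasurableSet G) (huniq : ∀ a b b', (a, b) ∈ G → (a, b') ∈ G → b = b')
    {f : Ω → α} {g : Ω → β} (hf : Measurable f) (hfg : ∀ ω, (f ω, g ω) ∈ G) : Measurable g := by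
  intro B hB
  -- Lusin–Souslin: the injective measurable image of a Borel set is Borel.
  have h1 : MeasurableSet (Prod.fst '' (G ∩ Prod.snd ⁻¹' B)) :=
    (hG.inter (measurable_snd hB)).image_of_measurable_injOn measurable_fst (by
      rintro ⟨a, b⟩ hab ⟨a', b'⟩ hab' rfl
      simp [huniq _ _ _ hab.1 hab'.1])
  have h2 : g ⁻¹' B = f ⁻¹' (Prod.fst '' (G ∩ Prod.snd ⁻¹' B)) := by
    ext ω
    constructor
    · intro h
      exact ⟨(f ω, g ω), ⟨hfg ω, h⟩, rfl⟩
    · rintro ⟨⟨a, b⟩, ⟨hab, hb⟩, rfl : a = f ω⟩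
      have := huniq _ _ _ hab (hfg ω)
      simpa [← this] using hb
  rw [h2]
  exact hf h1

lemma isClosed_posSemidef : IsClosed {A : Mat d | A.PosSemidef} := by
  have h : {A : Mat d | A.PosSemidef} =
      {A : Mat d | Aᵀ = A} ∩ ⋂ v : Fin d → ℝ, {A : Mat d | 0 ≤ v ⬝ᵥ A *ᵥ v} := by
    ext A
    simp only [Set.mem_ofPred_eq, Set.mem_inter_iff, Set.mem_iInter]
    exact ⟨fun h => ⟨transpose_eq_of_posSemidef h, posSemidef_quad_nonneg h⟩,
      fun h => posSemidef_of_quad_nonneg h.1 h.2⟩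
  rw [h]
  refine (isClosed_eq (by fun_prop) continuous_id).inter (isClosed_iInter fun v => ?_)
  exact isClosed_le continuous_const (by fun_prop)

lemma measurableSet_posDef : MeasurableSet {A : Mat d | A.PosDef} := by
  have h : {A : Mat d | A.PosDef} = {A : Mat d | A.PosSemidef} ∩ {A : Mat d | A.det = 0}ᶜ := by
    ext A
    simp only [Set.mem_ofPred_eq, Set.mem_inter_iff, Set.mem_compl_iff]
    exact ⟨fun h => ⟨h.posSemidef, h.posSemidef.posDef_iff_det_ne_zero.1 h⟩,
      fun h => h.1.posDef_iff_det_ne_zero.2 h.2⟩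
  rw [h]
  refine isClosed_posSemidef.measurableSet.inter (IsClosed.measurableSet ?_).compl
  exact isClosed_eq (by fun_prop) continuous_const

lemma isClosed_subalgebra (K : Subalgebra ℝ (Mat d)) : IsClosed (K : Set (Mat d)) :=
  (Subalgebra.toSubmodule K).closed_of_finiteDimensional

lemma measurable_preconditioner {Ω : Type*} [MeasurableSpace Ω] {𝓗 : Set (Mat d)}
    (h𝓗 : IsWellStructured 𝓗) {η : ℝ} (hη : d ≠ 0 → η ≠ 0) {M H : Ω → Mat d}
    (h : ∀ ω, IsPreconditioner 𝓗 η (M ω) (H ω)) (hM : Measurable M) : Measurable H := by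
  rcases eq_or_ne d 0 with rfl | hd
  · exact measurable_of_subsingleton_codomain _
  have hη := hη hd
  obtain ⟨K, hK⟩ := h𝓗
  -- The graph is cut out by the optimality equations instead of the minimization. There may be
  -- uncountably many, but each is a closed condition, so their intersection is closed.
  refine measurable_of_graph (G := {p : Mat d × Mat d | p.2.PosDef} ∩ ({p | p.2 ∈ K} ∩
    ⋂ E ∈ {E : Mat d | E ∈ K ∧ Eᵀ = E},
      {p | matInner p.1 E = η ^ 2 * (p.2 * E * p.2).trace})) ?_ ?_ hM ?_
  · refine (measurable_snd measurableSet_posDef).inter (IsClosed.measurableSet ?_)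
    refine ((isClosed_subalgebra K).preimage continuous_snd).inter
      (isClosed_biInter fun E _ => isClosed_eq ?_ (by fun_prop))
    unfold matInner
    fun_prop
  · rintro A B B' ⟨h1, h2, h3⟩ ⟨h1', h2', h3'⟩
    simp only [Set.mem_iInter, Set.mem_ofPred_eq] at h1 h2 h3 h1' h2' h3'
    refine eq_of_trace_eq h1 h1' h2 h2' fun E hE hEt => ?_
    exact mul_left_cancel₀ (pow_ne_zero 2 hη) ((h3' E ⟨hE, hEt⟩).symm.trans (h3 E ⟨hE, hEt⟩))
  · intro ω
    have hmem := (h ω).mem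
    rw [hK] at hmem
    refine ⟨(h ω).posDef, hmem.2, ?_⟩
    simp only [Set.mem_iInter, Set.mem_ofPred_eq]
    exact fun E hE => (h ω).matInner_left hK hE.1 hE.2

lemma continuous_matNorm : Continuous fun p : Mat d × Vec d => matNorm p.1 p.2 := by
  have : Continuous fun z : Mat d × Vec d => z.2.ofLp :=
    (PiLp.continuous_ofLp 2 _).comp continuous_snd
  unfold matNorm
  fun_prop

/-- `X` is not assumed closed or Borel. Minimality extends to the closure by continuity, so the
graph of the projection can be described with a closed set. -/
lemma IsProjection.closure {X : Set (Vec d)} {H : Mat d} {y z : Vec d}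
    (hz : z ∈ closure X) (h : ∀ z' ∈ X, matNorm H (y - z) ≤ matNorm H (y - z')) :
    IsProjection (closure X) H y z where
  mem := hz
  le z' hz' := by
    have hc : IsClosed {z' : Vec d | matNorm H (y - z) ≤ matNorm H (y - z')} :=
      isClosed_le continuous_const
        (continuous_matNorm.comp (continuous_const.prodMk (continuous_const.sub continuous_id)))
    exact closure_minimal h hc hz'

lemma IsProjection.unique {X : Set (Vec d)} (hX : Convex ℝ X) {H : Mat d} (hH : H.PosDef)
    {y z z' : Vec d} (h : IsProjection X H y z) (h' : IsProjection X H y z') : z = z' := by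
  have h1 := h.dotProduct_le_zero hX hH.posSemidef h'.mem
  have h2 := h'.dotProduct_le_zero hX hH.posSemidef h.mem
  have h3 : (z' - z).ofLp ⬝ᵥ H *ᵥ (z' - z).ofLp ≤ 0 := by
    simp only [WithLp.ofLp_sub, Matrix.mulVec_sub, dotProduct_sub, sub_dotProduct] at h1 h2 ⊢
    linarith
  by_contra hne
  have hv : (z' - z).ofLp ≠ 0 := fun h0 => hne (by
    have : z' - z = 0 := WithLp.ofLp_injective 2 h0
    exact (sub_eq_zero.1 this).symm)
  have h4 := hH.dotProduct_mulVec_pos hv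
  rw [star_trivial] at h4
  linarith

lemma measurable_projection {Ω : Type*} [MeasurableSpace Ω] {X : Set (Vec d)} (hX : Convex ℝ X)
    {H : Ω → Mat d} {y z : Ω → Vec d} (hp : ∀ ω, (H ω).PosDef)
    (h : ∀ ω, IsProjection X (H ω) (y ω) (z ω)) (hH : Measurable H) (hy : Measurable y) :
    Measurable z := by
  refine measurable_of_graph (G := {p : (Mat d × Vec d) × Vec d | p.1.1.PosDef} ∩
    ({p | p.2 ∈ closure X} ∩ ⋂ z' ∈ X,
      {p | matNorm p.1.1 (p.1.2 - p.2) ≤ matNorm p.1.1 (p.1.2 - z')})) ?_ ?_ (hH.prodMk hy) ?_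
  · refine ((measurable_fst.comp measurable_fst) measurableSet_posDef).inter
      (IsClosed.measurableSet ?_)
    refine (isClosed_closure.preimage continuous_snd).inter
      (isClosed_biInter fun z' _ => isClosed_le ?_ ?_)
    · exact continuous_matNorm.comp (f := fun p : (Mat d × Vec d) × Vec d =>
        (p.1.1, p.1.2 - p.2)) (by fun_prop)
    · exact continuous_matNorm.comp (f := fun p : (Mat d × Vec d) × Vec d =>
        (p.1.1, p.1.2 - z')) (by fun_prop)
  · rintro ⟨A, y⟩ z z' ⟨h1, h2, h3⟩ ⟨-, h2', h3'⟩
    simp only [Set.mem_iInter, Set.mem_ofPred_eq] at h1 h2 h3 h2' h3'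
    exact (IsProjection.closure h2 h3).unique hX.closure h1 (IsProjection.closure h2' h3')
  · intro ω
    refine ⟨hp ω, subset_closure (h ω).mem, ?_⟩
    simp only [Set.mem_iInter, Set.mem_ofPred_eq]
    exact (h ω).le

/-- The differentiable functions on `ℝ^d`, with the `σ`-algebra generated by evaluations. -/
abbrev DiffFun (d : ℕ) : Type := {f : Vec d → ℝ // Differentiable ℝ f}

/-- A Carathéodory function: continuous in the point and measurable in the loss. -/
lemma measurable_eval : Measurable fun p : DiffFun d × Vec d => p.1.1 p.2 := by
  have h := measurable_uncurry_of_continuous_of_measurable (u := fun (x : Vec d) (f : DiffFun d) =>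
    f.1 x) (fun f => f.2.continuous) (fun x => (measurable_pi_apply x).comp measurable_subtype_coe)
  exact h.comp measurable_swap

lemma tendsto_slope_gradient {f : Vec d → ℝ} {x : Vec d} (hf : DifferentiableAt ℝ f x)
    (v : Vec d) :
    Tendsto (fun n : ℕ => ((n : ℝ) + 1) * (f (x + (1 / ((n : ℝ) + 1)) • v) - f x)) atTop
      (𝓝 ((gradient f x).ofLp ⬝ᵥ v.ofLp)) := by
  have hl : HasDerivAt (fun s : ℝ => f (x + s • v)) (fderiv ℝ f x v) 0 := by
    have h1 : HasDerivAt (fun s : ℝ => x + s • v) v 0 := by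
      simpa using ((hasDerivAt_id (0 : ℝ)).smul_const v).const_add x
    have h2 : HasFDerivAt f (fderiv ℝ f x) (x + (0 : ℝ) • v) := by simpa using hf.hasFDerivAt
    exact h2.comp_hasDerivAt 0 h1
  have h4 : Tendsto (fun n : ℕ => 1 / ((n : ℝ) + 1)) atTop (𝓝[>] 0) :=
    tendsto_nhdsWithin_iff.2 ⟨tendsto_one_div_add_atTop_nhds_zero_nat,
      Eventually.of_forall fun n => by simp only [Set.mem_Ioi]; positivity⟩
  rw [← fderiv_apply_eq]
  simpa [Function.comp_def] using hl.tendsto_slope_zero_right.comp h4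

lemma measurable_gradient : Measurable fun p : DiffFun d × Vec d => gradient p.1.1 p.2 := by
  suffices h : Measurable fun p : DiffFun d × Vec d => (gradient p.1.1 p.2).ofLp from
    (WithLp.measurable_toLp 2 (Fin d → ℝ)).comp h
  refine measurable_pi_lambda _ fun i => ?_
  refine measurable_of_tendsto_metrizable
    (f := fun (n : ℕ) (p : DiffFun d × Vec d) => ((n : ℝ) + 1) *
      (p.1.1 (p.2 + (1 / ((n : ℝ) + 1)) • EuclideanSpace.single i (1 : ℝ)) - p.1.1 p.2)) ?_ ?_
  · intro n
    have h1 : Measurable fun p : DiffFun d × Vec d =>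
        p.1.1 (p.2 + (1 / ((n : ℝ) + 1)) • EuclideanSpace.single i (1 : ℝ)) :=
      measurable_eval.comp (f := fun p : DiffFun d × Vec d =>
        (p.1, p.2 + (1 / ((n : ℝ) + 1)) • EuclideanSpace.single i (1 : ℝ))) (by fun_prop)
    exact (h1.sub measurable_eval).const_mul _
  · rw [tendsto_pi_nhds]
    rintro ⟨f, x⟩
    simpa using tendsto_slope_gradient (f.2 x) (EuclideanSpace.single i 1)

lemma measurable_coord {Ω : Type*} [MeasurableSpace Ω] {f : Ω → Vec d} (hf : Measurable f)
    (i : Fin d) : Measurable fun ω => (f ω).ofLp i :=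
  (measurable_pi_apply i).comp ((WithLp.measurable_ofLp 2 (Fin d → ℝ)).comp hf)

/-- One step of the algorithm preserves measurability. -/
lemma measurable_step {Ω : Type*} [MeasurableSpace Ω] {𝓗 : Set (Mat d)}
    (h𝓗 : IsWellStructured 𝓗) {X : Set (Vec d)} (hX : Convex ℝ X) {η β : ℝ} (hη : d ≠ 0 → η ≠ 0)
    {g x z : Ω → Vec d} {M M' H : Ω → Mat d} (hg : Measurable g)
    (hM : Measurable M) (hx : Measurable x)
    (haccum : ∀ ω, M' ω = β • M ω + Matrix.vecMulVec (g ω).ofLp (g ω).ofLp)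
    (hpre : ∀ ω, IsPreconditioner 𝓗 η (M' ω) (H ω))
    (hstep : ∀ ω, IsProjection X (H ω) (x ω - WithLp.toLp 2 ((H ω)⁻¹ *ᵥ (g ω).ofLp)) (z ω)) :
    Measurable M' ∧ Measurable z := by
  have hgi : ∀ i, Measurable fun ω => (g ω).ofLp i := measurable_coord hg
  have hM' : Measurable M' := by
    rw [funext haccum]
    refine measurable_pi_lambda _ fun i => measurable_pi_lambda _ fun j => ?_
    have hij : Measurable fun ω => M ω i j :=
      (measurable_pi_apply j).comp ((measurable_pi_apply i).comp hM)
    exact (hij.const_mul β).add ((hgi i).mul (hgi j))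
  have hH := measurable_preconditioner h𝓗 hη hpre hM'
  refine ⟨hM', measurable_projection hX (fun ω => (hpre ω).posDef) hstep hH (hx.sub ?_)⟩
  refine (WithLp.measurable_toLp 2 (Fin d → ℝ)).comp (measurable_pi_lambda _ fun i => ?_)
  simp only [Matrix.inv_def, Ring.inverse_eq_inv', Matrix.smul_mulVec, Pi.smul_apply, smul_eq_mul]
  refine Measurable.mul ?_ ?_
  · exact ((Continuous.measurable (f := fun A : Mat d => A.det) (by fun_prop)).comp hH).inv
  · simp only [Matrix.mulVec, dotProduct]
    refine Finset.measurable_sum _ fun j _ => Measurable.mul ?_ (hgi j)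
    exact (Continuous.measurable (f := fun A : Mat d => A.adjugate i j) (by fun_prop)).comp hH

/-- The losses up to time `n` determine the iterate `x (n + 1)`. -/
lemma measurable_iterate {Ω : Type*} {T : ℕ} {𝓗 : Set (Mat d)} (h𝓗 : IsWellStructured 𝓗)
    {X : Set (Vec d)} (hX : Convex ℝ X) {ε η β : ℝ} (hη : d ≠ 0 → η ≠ 0)
    {ℓ : ℕ → Ω → Vec d → ℝ} (hdiff : ∀ t ∈ Finset.Icc 1 T, ∀ ω, Differentiable ℝ (ℓ t ω))
    {x₁ : Vec d} {x : ℕ → Ω → Vec d} {M H : ℕ → Ω → Mat d}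
    (hrun : ∀ ω, IsWeightedRun T 𝓗 X ε η β x₁
      (fun t => ℓ t ω) (fun t => x t ω) (fun t => M t ω) (fun t => H t ω))
    (n : ℕ) (hn : n ≤ T) (m : MeasurableSpace Ω)
    (hm : ∀ t ∈ Finset.Icc 1 n, Measurable (ℓ t)) : Measurable (x (n + 1)) ∧ Measurable (M n) := by
  induction n with
  | zero =>
    have h1 : x (0 + 1) = fun _ => x₁ := funext fun ω => (hrun ω).init
    have h2 : M 0 = fun _ => ε • (1 : Mat d) := funext fun ω => (hrun ω).accum_zero
    rw [h1, h2]
    exact ⟨measurable_const, measurable_const⟩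
  | succ n ih =>
    obtain ⟨hx, hM⟩ := ih (by omega) fun t ht => hm t (by simp at ht ⊢; omega)
    have ht : n + 1 ∈ Finset.Icc 1 T := by simp; omega
    have hg : Measurable fun ω => gradient (ℓ (n + 1) ω) (x (n + 1) ω) :=
      measurable_gradient.comp (f := fun ω => ((⟨ℓ (n + 1) ω, hdiff _ ht ω⟩ : DiffFun d),
        x (n + 1) ω)) (((hm (n + 1) (by simp)).subtype_mk).prodMk hx)
    have := measurable_step h𝓗 hX hη hg hM hx (M' := M (n + 1))
      (fun ω => (hrun ω).accum_step _ ht)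
      (fun ω => (hrun ω).precond _ ht) (fun ω => (hrun ω).step _ ht)
    exact ⟨this.2, this.1⟩

/-! ### Independence and integration one variable at a time. -/

/-- The iterate `x t` is independent of the loss at time `t`. -/
lemma indepFun_iterate {Ω : Type*} [mΩ : MeasurableSpace Ω] {μ : Measure Ω}
    {T : ℕ} {𝓗 : Set (Mat d)} (h𝓗 : IsWellStructured 𝓗)
    {X : Set (Vec d)} (hX : Convex ℝ X) {ε η β : ℝ} (hη : d ≠ 0 → η ≠ 0)
    {ℓ : ℕ → Ω → Vec d → ℝ} (hdiff : ∀ t ∈ Finset.Icc 1 T, ∀ ω, Differentiable ℝ (ℓ t ω))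
    (hmeas : ∀ t ∈ Finset.Icc 1 T, Measurable (ℓ t))
    (hindep : iIndepFun (fun (t : Finset.Icc 1 T) (ω : Ω) => ℓ t ω) μ)
    {x₁ : Vec d} {x : ℕ → Ω → Vec d} {M H : ℕ → Ω → Mat d}
    (hrun : ∀ ω, IsWeightedRun T 𝓗 X ε η β x₁
      (fun t => ℓ t ω) (fun t => x t ω) (fun t => M t ω) (fun t => H t ω))
    {t : ℕ} (ht : t ∈ Finset.Icc 1 T) :
    IndepFun (fun ω => (⟨ℓ t ω, hdiff t ht ω⟩ : DiffFun d)) (x t) μ := by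
  rw [IndepFun_iff_Indep]
  have h1 := indep_iSup_of_disjoint
    (fun i : Finset.Icc 1 T => (hmeas i i.2).comap_le) hindep.iIndep
    (S := {⟨t, ht⟩}) (T := {s | s.1 < t}) (by simp)
  refine indep_of_indep_of_le h1 ?_ ?_
  · rw [← measurable_iff_comap_le]
    refine Measurable.subtype_mk ?_
    rw [measurable_iff_comap_le]
    exact le_iSup₂_of_le (⟨t, ht⟩ : Finset.Icc 1 T) rfl le_rfl
  · rw [← measurable_iff_comap_le]
    have ht' := Finset.mem_Icc.1 ht
    -- Measurability is applied with the `σ`-algebra generated by the losses before time `t`, not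
    -- the ambient one.
    have h2 := (measurable_iterate h𝓗 hX hη hdiff hrun (t - 1) (by omega)
      (⨆ s ∈ {s : Finset.Icc 1 T | s.1 < t}, MeasurableSpace.comap (fun ω => ℓ s ω) inferInstance)
      ?_).1
    · rwa [Nat.sub_add_cancel ht'.1] at h2
    · intro s hs
      rw [Finset.mem_Icc] at hs
      rw [measurable_iff_comap_le]
      exact le_iSup₂_of_le (⟨s, by simp; omega⟩ : Finset.Icc 1 T)
        (by simp only [Set.mem_ofPred_eq]; omega) le_rfl

/-- Integration of a function of two independent variables, one variable at a time. -/
lemma IndepFun.integral_eq {Ω α γ : Type*} [MeasurableSpace Ω] [MeasurableSpace α]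
    [MeasurableSpace γ] {μ : Measure Ω} [IsProbabilityMeasure μ] {ζ : Ω → α} {ξ : Ω → γ}
    (h : IndepFun ζ ξ μ) (hζ : Measurable ζ) (hξ : Measurable ξ) {φ : α × γ → ℝ}
    (hφ : Measurable φ) (hi : Integrable (fun ω => φ (ζ ω, ξ ω)) μ) :
    ∫ ω, φ (ζ ω, ξ ω) ∂μ = ∫ ω, ∫ ω', φ (ζ ω', ξ ω) ∂μ ∂μ := by
  have h1 := (indepFun_iff_map_prod_eq_prod_map_map hζ.aemeasurable hξ.aemeasurable).1 h
  have h2 : Integrable φ ((μ.map ζ).prod (μ.map ξ)) := by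
    rw [← h1]
    exact (integrable_map_measure hφ.aestronglyMeasurable (hζ.prodMk hξ).aemeasurable).2 hi
  have : IsProbabilityMeasure (μ.map ζ) := Measure.isProbabilityMeasure_map hζ.aemeasurable
  have : IsProbabilityMeasure (μ.map ξ) := Measure.isProbabilityMeasure_map hξ.aemeasurable
  rw [← integral_map (hζ.prodMk hξ).aemeasurable hφ.aestronglyMeasurable, h1,
    integral_prod_symm _ h2, integral_map hξ.aemeasurable]
  · refine integral_congr_ae (Eventually.of_forall fun ω => ?_)
    exact integral_map hζ.aemeasurable (hφ.comp measurable_prodMk_right).aestronglyMeasurable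
  · exact h2.swap.integral_prod_left.aestronglyMeasurable

lemma IndepFun.lintegral_eq {Ω α γ : Type*} [MeasurableSpace Ω] [MeasurableSpace α]
    [MeasurableSpace γ] {μ : Measure Ω} [IsProbabilityMeasure μ] {ζ : Ω → α} {ξ : Ω → γ}
    (h : IndepFun ζ ξ μ) (hζ : Measurable ζ) (hξ : Measurable ξ) {φ : α × γ → ENNReal}
    (hφ : Measurable φ) :
    ∫⁻ ω, φ (ζ ω, ξ ω) ∂μ = ∫⁻ ω, ∫⁻ ω', φ (ζ ω', ξ ω) ∂μ ∂μ := by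
  have h1 := (indepFun_iff_map_prod_eq_prod_map_map hζ.aemeasurable hξ.aemeasurable).1 h
  have : IsProbabilityMeasure (μ.map ζ) := Measure.isProbabilityMeasure_map hζ.aemeasurable
  have : IsProbabilityMeasure (μ.map ξ) := Measure.isProbabilityMeasure_map hξ.aemeasurable
  rw [← lintegral_map hφ (hζ.prodMk hξ), h1, lintegral_prod_symm _ hφ.aemeasurable,
    lintegral_map hφ.lintegral_prod_left' hξ]
  refine lintegral_congr fun ω => ?_
  exact lintegral_map (hφ.comp measurable_prodMk_right) hζ

/-! ### Convexity and differentiation under the expectation. -/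

lemma slope_le_of_convexOn {f : Vec d → ℝ} {s : Set (Vec d)} (hf : ConvexOn ℝ s f) {x y : Vec d}
    (hx : x ∈ s) (hy : y ∈ s) (n : ℕ) :
    ((n : ℝ) + 1) * (f (x + (1 / ((n : ℝ) + 1)) • (y - x)) - f x) ≤ f y - f x := by
  have hn : (0 : ℝ) < (n : ℝ) + 1 := by positivity
  set a : ℝ := 1 / ((n : ℝ) + 1) with ha
  have ha0 : 0 ≤ a := by positivity
  have ha1 : a ≤ 1 := by rw [ha, div_le_one hn]; linarith [(Nat.cast_nonneg n : (0 : ℝ) ≤ n)]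
  have h := hf.2 hx hy (sub_nonneg.2 ha1) ha0 (by ring)
  have e : x + a • (y - x) = (1 - a) • x + a • y := by module
  rw [e]
  simp only [smul_eq_mul] at h
  have hna : ((n : ℝ) + 1) * a = 1 := by rw [ha]; field_simp
  calc ((n : ℝ) + 1) * (f ((1 - a) • x + a • y) - f x)
      ≤ ((n : ℝ) + 1) * (a * (f y - f x)) := mul_le_mul_of_nonneg_left (by linarith) hn.le
    _ = f y - f x := by rw [← mul_assoc, hna, one_mul]

/-- First-order convexity inequality. -/
lemma gradient_dot_le_of_convexOn {f : Vec d → ℝ} {s : Set (Vec d)} (hf : ConvexOn ℝ s f)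
    {x y : Vec d} (hx : x ∈ s) (hy : y ∈ s) (hd : DifferentiableAt ℝ f x) :
    (gradient f x).ofLp ⬝ᵥ (y - x).ofLp ≤ f y - f x :=
  le_of_tendsto' (tendsto_slope_gradient hd (y - x)) fun n => slope_le_of_convexOn hf hx hy n

section Expectation

variable {Ω : Type*} [MeasurableSpace Ω] {μ : Measure Ω}
  {ℓ : Ω → Vec d → ℝ} {L : Vec d → ℝ} {U : Set (Vec d)}

lemma convexOn_expectation (hU : Convex ℝ U) (hconv : ∀ ω, ConvexOn ℝ Set.univ (ℓ ω))
    (hint : ∀ x ∈ U, Integrable (fun ω => ℓ ω x) μ) (hexp : ∀ x ∈ U, ∫ ω, ℓ ω x ∂μ = L x) :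
    ConvexOn ℝ U L := by
  refine ⟨hU, fun x hx y hy a b ha hb hab => ?_⟩
  rw [← hexp _ (hU hx hy ha hb hab), ← hexp x hx, ← hexp y hy, smul_eq_mul, smul_eq_mul,
    ← integral_const_mul, ← integral_const_mul,
    ← integral_add ((hint x hx).const_mul a) ((hint y hy).const_mul b)]
  refine integral_mono (hint _ (hU hx hy ha hb hab))
    (((hint x hx).const_mul a).add ((hint y hy).const_mul b)) fun ω => ?_
  exact (hconv ω).2 (Set.mem_univ _) (Set.mem_univ _) ha hb hab

/-- Differentiation under the expectation, for convex losses. -/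
lemma integral_gradient (hU : Convex ℝ U) (hUi : (interior U).Nonempty)
    (hconv : ∀ ω, ConvexOn ℝ Set.univ (ℓ ω)) (hdiff : ∀ ω, Differentiable ℝ (ℓ ω))
    (hint : ∀ x ∈ U, Integrable (fun ω => ℓ ω x) μ) (hexp : ∀ x ∈ U, ∫ ω, ℓ ω x ∂μ = L x)
    {x : Vec d} (hx : x ∈ U) (hL : DifferentiableAt ℝ L x)
    (hg : ∀ i, Integrable (fun ω => (gradient (ℓ ω) x).ofLp i) μ) (i : Fin d) :
    ∫ ω, (gradient (ℓ ω) x).ofLp i ∂μ = (gradient L x).ofLp i := by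
  have hgv : ∀ v : Vec d, Integrable (fun ω => (gradient (ℓ ω) x).ofLp ⬝ᵥ v.ofLp) μ := fun v =>
    integrable_finsetSum _ fun j _ => (hg j).mul_const _
  have key : ∀ y ∈ U, ∫ ω, (gradient (ℓ ω) x).ofLp ⬝ᵥ (y - x).ofLp ∂μ =
      (gradient L x).ofLp ⬝ᵥ (y - x).ofLp := by
    intro y hy
    have hmem : ∀ n : ℕ, x + (1 / ((n : ℝ) + 1)) • (y - x) ∈ U := fun n => by
      refine hU.add_smul_sub_mem hx hy ⟨by positivity, ?_⟩
      rw [div_le_one (by positivity)]; linarith [(Nat.cast_nonneg n : (0 : ℝ) ≤ n)]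
    have hi : ∀ n : ℕ, Integrable (fun ω => ((n : ℝ) + 1) *
        (ℓ ω (x + (1 / ((n : ℝ) + 1)) • (y - x)) - ℓ ω x)) μ := fun n =>
      ((hint _ (hmem n)).sub (hint x hx)).const_mul _
    have h1 : Tendsto (fun n : ℕ => ∫ ω, ((n : ℝ) + 1) *
        (ℓ ω (x + (1 / ((n : ℝ) + 1)) • (y - x)) - ℓ ω x) ∂μ) atTop
        (𝓝 (∫ ω, (gradient (ℓ ω) x).ofLp ⬝ᵥ (y - x).ofLp ∂μ)) := by
      -- By convexity every slope lies between the directional derivative at `x` and `ℓ(y) - ℓ(x)`,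
      -- both integrable.
      refine tendsto_integral_of_dominated_convergence
        (fun ω => |ℓ ω y - ℓ ω x| + |(gradient (ℓ ω) x).ofLp ⬝ᵥ (y - x).ofLp|)
        (fun n => (hi n).aestronglyMeasurable)
        (((hint y hy).sub (hint x hx)).abs.add (hgv (y - x)).abs)
        (fun n => Eventually.of_forall fun ω => ?_)
        (Eventually.of_forall fun ω => tendsto_slope_gradient (hdiff ω x) _)
      have hn : (0 : ℝ) < (n : ℝ) + 1 := by positivity
      have hup := slope_le_of_convexOn (hconv ω) (Set.mem_univ x) (Set.mem_univ y) n
      have hlo := gradient_dot_le_of_convexOn (hconv ω) (Set.mem_univ x)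
        (Set.mem_univ (x + (1 / ((n : ℝ) + 1)) • (y - x))) (hdiff ω x)
      rw [add_sub_cancel_left, WithLp.ofLp_smul, dotProduct_smul, smul_eq_mul] at hlo
      have hlo' := mul_le_mul_of_nonneg_left hlo hn.le
      rw [← mul_assoc, mul_one_div_cancel hn.ne', one_mul] at hlo'
      rw [Real.norm_eq_abs, abs_le]
      constructor
      · linarith [neg_abs_le ((gradient (ℓ ω) x).ofLp ⬝ᵥ (y - x).ofLp),
          abs_nonneg (ℓ ω y - ℓ ω x)]
      · linarith [le_abs_self (ℓ ω y - ℓ ω x),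
          abs_nonneg ((gradient (ℓ ω) x).ofLp ⬝ᵥ (y - x).ofLp)]
    refine tendsto_nhds_unique h1 ((tendsto_slope_gradient hL (y - x)).congr fun n => ?_)
    rw [integral_const_mul, integral_sub (hint _ (hmem n)) (hint x hx), hexp _ (hmem n),
      hexp x hx]
  -- So far only directions `y - x` with `y ∈ U` are covered, and `x` may be a boundary point. Two
  -- points near an interior point that differ by a multiple of `e_i` isolate the coordinate.
  obtain ⟨y, hy⟩ := hUi
  obtain ⟨r, hr, hball⟩ := Metric.isOpen_iff.1 isOpen_interior y hy
  set e : Vec d := EuclideanSpace.single i 1 with he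
  have hy' : y + (r / 2) • e ∈ U := by
    refine interior_subset (hball ?_)
    rw [Metric.mem_ball, dist_eq_norm, add_sub_cancel_left, norm_smul, he,
      PiLp.norm_single, Real.norm_of_nonneg (by positivity)]
    norm_num; linarith
  have h1 := key y (interior_subset hy)
  have h2 := key _ hy'
  have e1 : y + (r / 2) • e - x = (y - x) + (r / 2) • e := by abel
  have e2 : ∀ u : Vec d, u.ofLp ⬝ᵥ (y + (r / 2) • e - x).ofLp =
      u.ofLp ⬝ᵥ (y - x).ofLp + r / 2 * u.ofLp i := fun u => by
    rw [e1, WithLp.ofLp_add, dotProduct_add, WithLp.ofLp_smul, dotProduct_smul]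
    simp [he]
  simp only [e2] at h2
  rw [integral_add (hgv _) ((hg i).const_mul _), h1, integral_const_mul] at h2
  exact mul_left_cancel₀ (by positivity : r / 2 ≠ 0) (add_left_cancel h2)

end Expectation

/-! ### Moments of centered noise. -/

section Noise

variable {Ω α γ : Type*} [MeasurableSpace Ω] [MeasurableSpace α] [MeasurableSpace γ]
  {μ : Measure Ω} {ζ : Ω → α} {ξ : Ω → γ} {φ : α × γ → Fin d → ℝ} {S : Mat d}

lemma integral_quad {n : Ω → Fin d → ℝ} (hn : ∀ i j, Integrable (fun ω => n ω i * n ω j) μ)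
    (Q : Mat d) : Integrable (fun ω => n ω ⬝ᵥ Q *ᵥ n ω) μ ∧ ∫ ω, n ω ⬝ᵥ Q *ᵥ n ω ∂μ =
      matInner (Matrix.of fun i j => ∫ ω, n ω i * n ω j ∂μ) Q := by
  have h1 : (fun ω => n ω ⬝ᵥ Q *ᵥ n ω) = fun ω => ∑ i, ∑ j, Q i j * (n ω i * n ω j) := by
    funext ω
    simp only [dotProduct, Matrix.mulVec, Finset.mul_sum]
    exact Finset.sum_congr rfl fun i _ => Finset.sum_congr rfl fun j _ => by ring
  have h2 : ∀ i j, Integrable (fun ω => Q i j * (n ω i * n ω j)) μ := fun i j =>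
    (hn i j).const_mul _
  have h3 : ∀ i, Integrable (fun ω => ∑ j, Q i j * (n ω i * n ω j)) μ := fun i =>
    integrable_finsetSum _ fun j _ => h2 i j
  rw [h1]
  refine ⟨integrable_finsetSum _ fun i _ => h3 i, ?_⟩
  refine (integral_finsetSum _ fun i _ => h3 i).trans ?_
  simp only [matInner, Matrix.trace, Matrix.diag, Matrix.mul_apply, Matrix.transpose_apply,
    Matrix.of_apply]
  rw [Finset.sum_comm]
  refine Finset.sum_congr rfl fun i _ => ?_
  refine (integral_finsetSum _ fun j _ => h2 i j).trans ?_
  refine Finset.sum_congr rfl fun j _ => ?_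
  rw [integral_const_mul, mul_comm]

/-- A random vector `φ (ζ, ξ)` with `ζ` independent of `ξ` which, for every frozen value of `ξ`,
is centered and has second moment matrix at most `S`. -/
structure CenteredNoise (μ : Measure Ω) (ζ : Ω → α) (ξ : Ω → γ) (φ : α × γ → Fin d → ℝ)
    (S : Mat d) : Prop where
  measurable_left : Measurable ζ
  measurable_right : Measurable ξ
  measurable : ∀ i, Measurable fun p => φ p i
  indep : IndepFun ζ ξ μ
  integrable_mul : ∀ ω i j, Integrable (fun ω' => φ (ζ ω', ξ ω) i * φ (ζ ω', ξ ω) j) μ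
  second_moment_le : ∀ ω, (S - Matrix.of fun i j =>
    ∫ ω', φ (ζ ω', ξ ω) i * φ (ζ ω', ξ ω) j ∂μ).PosSemidef
  centered : ∀ ω i, ∫ ω', φ (ζ ω', ξ ω) i ∂μ = 0

namespace CenteredNoise

variable [IsProbabilityMeasure μ]

/-- Joint integrability is not assumed: Tonelli bounds the second moment by the frozen ones, each at
most `S i i`. -/
lemma memLp (h : CenteredNoise μ ζ ξ φ S) (i : Fin d) :
    MemLp (fun ω => φ (ζ ω, ξ ω) i) 2 μ := by
  have hm : Measurable fun ω => φ (ζ ω, ξ ω) i :=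
    (h.measurable i).comp (h.measurable_left.prodMk h.measurable_right)
  rw [memLp_two_iff_integrable_sq hm.aestronglyMeasurable]
  refine ⟨(hm.pow_const 2).aestronglyMeasurable, ?_⟩
  rw [hasFiniteIntegral_iff_ofReal (Eventually.of_forall fun ω => sq_nonneg _)]
  have h1 := IndepFun.lintegral_eq h.indep h.measurable_left h.measurable_right
    (φ := fun p => ENNReal.ofReal (φ p i ^ 2)) ((h.measurable i).pow_const 2).ennreal_ofReal
  rw [h1]
  refine lt_of_le_of_lt (lintegral_mono (g := fun _ => ENNReal.ofReal (S i i)) fun ω => ?_)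
    (by simp)
  have h2 : Integrable (fun ω' => φ (ζ ω', ξ ω) i ^ 2) μ := by
    simpa only [pow_two] using h.integrable_mul ω i i
  rw [← ofReal_integral_eq_lintegral_ofReal h2 (Eventually.of_forall fun ω' => sq_nonneg _)]
  refine ENNReal.ofReal_le_ofReal ?_
  have h3 := (h.second_moment_le ω).diag_nonneg (i := i)
  rw [Matrix.sub_apply, Matrix.of_apply] at h3
  simp only [pow_two]
  linarith

lemma integrable_mul_self (h : CenteredNoise μ ζ ξ φ S) (i j : Fin d) :
    Integrable (fun ω => φ (ζ ω, ξ ω) i * φ (ζ ω, ξ ω) j) μ :=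
  (h.memLp i).integrable_mul (h.memLp j)

lemma integral_quad_le (h : CenteredNoise μ ζ ξ φ S) {Q : Mat d} (hQ : Q.PosSemidef) :
    ∫ ω, φ (ζ ω, ξ ω) ⬝ᵥ Q *ᵥ φ (ζ ω, ξ ω) ∂μ ≤ matInner S Q := by
  have hm : Measurable fun p => φ p ⬝ᵥ Q *ᵥ φ p := by
    simp only [dotProduct, Matrix.mulVec]
    exact Finset.measurable_sum _ fun i _ => (h.measurable i).mul
      (Finset.measurable_sum _ fun j _ => (h.measurable j).const_mul _)
  rw [IndepFun.integral_eq h.indep h.measurable_left h.measurable_right hm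
    (integral_quad h.integrable_mul_self Q).1]
  calc _ ≤ ∫ _, matInner S Q ∂μ := by
        refine integral_mono_of_nonneg
          (Eventually.of_forall fun ω => integral_nonneg fun ω' => posSemidef_quad_nonneg hQ _)
          (integrable_const _) (Eventually.of_forall fun ω => ?_)
        have h1 := matInner_nonneg (h.second_moment_le ω) hQ
        rw [matInner_sub_left] at h1
        have h2 := (integral_quad (h.integrable_mul ω) Q).2
        simp only []
        linarith
    _ = matInner S Q := by simp

/-- The noise is uncorrelated with every bounded function of the frozen variable. -/
lemma integral_dot (h : CenteredNoise μ ζ ξ φ S) {v : γ → Fin d → ℝ}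
    (hv : ∀ i, Measurable fun x => v x i) (hb : ∀ i, ∃ C, ∀ ω, ‖v (ξ ω) i‖ ≤ C) :
    Integrable (fun ω => φ (ζ ω, ξ ω) ⬝ᵥ v (ξ ω)) μ ∧
    ∫ ω, φ (ζ ω, ξ ω) ⬝ᵥ v (ξ ω) ∂μ = 0 := by
  have hm : Measurable fun p : α × γ => φ p ⬝ᵥ v p.2 :=
    Finset.measurable_sum _ fun i _ => (h.measurable i).mul ((hv i).comp measurable_snd)
  have hi : Integrable (fun ω => φ (ζ ω, ξ ω) ⬝ᵥ v (ξ ω)) μ := by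
    refine integrable_finsetSum _ fun i _ => ?_
    obtain ⟨C, hC⟩ := hb i
    exact ((h.memLp i).integrable (by norm_num)).mul_bdd
      ((hv i).comp h.measurable_right).aestronglyMeasurable (Eventually.of_forall hC)
  refine ⟨hi, ?_⟩
  rw [IndepFun.integral_eq h.indep h.measurable_left h.measurable_right hm hi]
  refine integral_eq_zero_of_ae (Eventually.of_forall fun ω => ?_)
  have hin : ∀ i ∈ Finset.univ, Integrable (fun ω' => φ (ζ ω', ξ ω) i * v (ξ ω) i) μ := by
    intro i _
    refine Integrable.mul_const ?_ _
    have hmi : Measurable fun ω' => φ (ζ ω', ξ ω) i :=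
      (h.measurable i).comp (h.measurable_left.prodMk measurable_const)
    refine ((memLp_two_iff_integrable_sq hmi.aestronglyMeasurable).2 ?_).integrable (by norm_num)
    simpa only [pow_two] using h.integrable_mul ω i i
  simp only [dotProduct, Pi.zero_apply]
  rw [integral_finsetSum _ hin]
  refine Finset.sum_eq_zero fun i _ => ?_
  rw [integral_mul_const, h.centered ω, zero_mul]

variable {g : Ω → Fin d → ℝ} {G : γ → Fin d → ℝ}

lemma integral_add_dot (h : CenteredNoise μ ζ ξ φ S)
    (hg : ∀ ω, g ω = φ (ζ ω, ξ ω) + G (ξ ω)) {v : γ → Fin d → ℝ}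
    (hv : ∀ i, Measurable fun x => v x i) (hb : ∀ i, ∃ C, ∀ ω, ‖v (ξ ω) i‖ ≤ C)
    (hi : Integrable (fun ω => G (ξ ω) ⬝ᵥ v (ξ ω)) μ) :
    Integrable (fun ω => g ω ⬝ᵥ v (ξ ω)) μ ∧
    ∫ ω, g ω ⬝ᵥ v (ξ ω) ∂μ = ∫ ω, G (ξ ω) ⬝ᵥ v (ξ ω) ∂μ := by
  obtain ⟨h1, h2⟩ := h.integral_dot hv hb
  simp only [hg, add_dotProduct]
  exact ⟨h1.add hi, by rw [integral_add h1 hi, h2, zero_add]⟩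

/-- The cross term vanishes in expectation, since `Q G(ξ)` is a bounded function of the frozen
variable. -/
lemma integral_add_quad_le (h : CenteredNoise μ ζ ξ φ S)
    (hg : ∀ ω, g ω = φ (ζ ω, ξ ω) + G (ξ ω)) (hG : ∀ i, Measurable fun x => G x i)
    {Q : Mat d} (hQ : Q.PosSemidef) (hb : ∀ i, ∃ C, ∀ ω, ‖(Q *ᵥ G (ξ ω)) i‖ ≤ C)
    (hi : Integrable (fun ω => G (ξ ω) ⬝ᵥ Q *ᵥ G (ξ ω)) μ) :
    Integrable (fun ω => g ω ⬝ᵥ Q *ᵥ g ω) μ ∧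
    ∫ ω, g ω ⬝ᵥ Q *ᵥ g ω ∂μ ≤ matInner S Q + ∫ ω, G (ξ ω) ⬝ᵥ Q *ᵥ G (ξ ω) ∂μ := by
  have hQt := transpose_eq_of_posSemidef hQ
  have hv : ∀ i, Measurable fun x => (Q *ᵥ G x) i := fun i => by
    simp only [Matrix.mulVec, dotProduct]
    exact Finset.measurable_sum _ fun j _ => (hG j).const_mul _
  obtain ⟨h1, h2⟩ := h.integral_dot hv hb
  have h4 := (integral_quad h.integrable_mul_self Q).1
  have h5 := h.integral_quad_le hQ
  have e : (fun ω => g ω ⬝ᵥ Q *ᵥ g ω) = fun ω => φ (ζ ω, ξ ω) ⬝ᵥ Q *ᵥ φ (ζ ω, ξ ω) +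
      2 * (φ (ζ ω, ξ ω) ⬝ᵥ Q *ᵥ G (ξ ω)) + G (ξ ω) ⬝ᵥ Q *ᵥ G (ξ ω) := by
    funext ω
    rw [hg, Matrix.mulVec_add, dotProduct_add, add_dotProduct, add_dotProduct,
      dotProduct_mulVec_comm hQt (G (ξ ω)) (φ (ζ ω, ξ ω))]
    ring
  have h6 := h1.const_mul 2
  rw [e]
  refine ⟨(h4.add h6).add hi, ?_⟩
  have h7 : ∫ ω, (φ (ζ ω, ξ ω) ⬝ᵥ Q *ᵥ φ (ζ ω, ξ ω) + 2 * (φ (ζ ω, ξ ω) ⬝ᵥ Q *ᵥ G (ξ ω)) +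
      G (ξ ω) ⬝ᵥ Q *ᵥ G (ξ ω)) ∂μ = ∫ ω, φ (ζ ω, ξ ω) ⬝ᵥ Q *ᵥ φ (ζ ω, ξ ω) ∂μ + 2 * 0 +
      ∫ ω, G (ξ ω) ⬝ᵥ Q *ᵥ G (ξ ω) ∂μ := by
    rw [← h2, ← integral_const_mul, ← integral_add h4 h6]
    exact integral_add (h4.add h6) hi
  rw [h7]
  linarith

end CenteredNoise

end Noise

lemma exists_bound_of_continuous {Ω : Type*} {X : Set (Vec d)} (hX : Bornology.IsBounded X)
    {ξ : Ω → Vec d} (hξX : ∀ ω, ξ ω ∈ X) {h : Vec d → ℝ} (hh : Continuous h) :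
    ∃ C, ∀ ω, ‖h (ξ ω)‖ ≤ C := by
  obtain ⟨C, hC⟩ := hX.isCompact_closure.exists_bound_of_continuousOn hh.continuousOn
  exact ⟨C, fun ω => hC _ (subset_closure (hξX ω))⟩

lemma integrable_of_continuous {Ω : Type*} [MeasurableSpace Ω] {μ : Measure Ω}
    [IsProbabilityMeasure μ] {X : Set (Vec d)} (hX : Bornology.IsBounded X)
    {ξ : Ω → Vec d} (hξ : Measurable ξ) (hξX : ∀ ω, ξ ω ∈ X) {h : Vec d → ℝ} (hh : Continuous h) :
    Integrable (fun ω => h (ξ ω)) μ := by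
  obtain ⟨C, hC⟩ := exists_bound_of_continuous hX hξX hh
  exact Integrable.of_bound (hh.measurable.comp hξ).aestronglyMeasurable C
    (Eventually.of_forall hC)

lemma NoiseBoundedBy.integral_eq_zero {Ω : Type*} [MeasurableSpace Ω] {μ : Measure Ω}
    [IsProbabilityMeasure μ] {ℓ : Ω → Vec d → ℝ} {L : Vec d → ℝ} {U X : Set (Vec d)} {S : Mat d}
    (hU : Convex ℝ U) (hUi : (interior U).Nonempty) (hXU : X ⊆ U)
    (hmeas : Measurable ℓ)
    (hconv : ∀ ω, ConvexOn ℝ Set.univ (ℓ ω)) (hdiff : ∀ ω, Differentiable ℝ (ℓ ω))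
    (hint : ∀ x ∈ U, Integrable (fun ω => ℓ ω x) μ) (hexp : ∀ x ∈ U, ∫ ω, ℓ ω x ∂μ = L x)
    (hL : Differentiable ℝ L) (h : NoiseBoundedBy μ X ℓ L S) {x : Vec d} (hx : x ∈ X)
    (i : Fin d) : ∫ ω, (gradient (ℓ ω) x - gradient L x).ofLp i ∂μ = 0 := by
  have hm : Measurable fun ω => gradient (ℓ ω) x :=
    measurable_gradient.comp (f := fun ω => ((⟨ℓ ω, hdiff ω⟩ : DiffFun d), x))
      (hmeas.subtype_mk.prodMk measurable_const)
  have hn : ∀ j, Integrable (fun ω => (gradient (ℓ ω) x - gradient L x).ofLp j) μ := fun j => by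
    refine ((memLp_two_iff_integrable_sq (measurable_coord (hm.sub_const _)
      j).aestronglyMeasurable).2 ?_).integrable (by norm_num)
    have h1 := (h x hx).1 j j
    simp only [noiseOuter, Matrix.vecMulVec_apply] at h1
    simpa only [pow_two] using h1
  have hg : ∀ j, Integrable (fun ω => (gradient (ℓ ω) x).ofLp j) μ := fun j => by
    have h1 := (hn j).add (integrable_const ((gradient L x).ofLp j))
    refine h1.congr (Eventually.of_forall fun ω => ?_)
    simp
  have h2 := integral_gradient hU hUi hconv hdiff hint hexp (hXU hx) (hL x) hg i
  simp only [WithLp.ofLp_sub, Pi.sub_apply]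
  rw [integral_sub (hg i) (integrable_const _), h2]
  simp

/-! ### Optimization of scalars and bounds for inverses. -/

/-- The optimal `c` is `√(A/B)`. Adding `δ` to both coefficients keeps it defined and positive when
one vanishes; then `δ → 0`. -/
lemma le_add_two_mul_sqrt {a b A B : ℝ} (hA : 0 ≤ A) (hB : 0 ≤ B)
    (h : ∀ c : ℝ, 0 < c → a ≤ b + (A / c + B * c)) : a ≤ b + 2 * √(A * B) := by
  have key : ∀ δ : ℝ, 0 < δ → a ≤ b + 2 * √((A + δ) * (B + δ)) := by
    intro δ hδ
    have hA' : 0 < A + δ := by linarith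
    have hB' : 0 < B + δ := by linarith
    set p := √(A + δ) with hp
    set q := √(B + δ) with hq
    have hp0 : 0 < p := Real.sqrt_pos.2 hA'
    have hq0 : 0 < q := Real.sqrt_pos.2 hB'
    have hp2 : p ^ 2 = A + δ := Real.sq_sqrt hA'.le
    have hq2 : q ^ 2 = B + δ := Real.sq_sqrt hB'.le
    have h1 := h (p / q) (by positivity)
    rw [Real.sqrt_mul hA'.le, ← hp, ← hq]
    have h2 : A / (p / q) ≤ p ^ 2 / (p / q) := by
      gcongr; rw [hp2]; linarith
    have h3 : B * (p / q) ≤ q ^ 2 * (p / q) := by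
      gcongr; rw [hq2]; linarith
    have h4 : p ^ 2 / (p / q) = p * q := by field_simp
    have h5 : q ^ 2 * (p / q) = p * q := by field_simp
    linarith
  have hlim : Tendsto (fun δ : ℝ => b + 2 * √((A + δ) * (B + δ))) (𝓝[>] 0)
      (𝓝 (b + 2 * √(A * B))) := by
    have hc : Continuous fun δ : ℝ => b + 2 * √((A + δ) * (B + δ)) := by fun_prop
    simpa using (hc.tendsto 0).mono_left nhdsWithin_le_nhds
  exact ge_of_tendsto hlim (eventually_mem_nhdsWithin.mono fun δ hδ => key δ hδ)

lemma le_of_forall_add_mul_le {a b c : ℝ} (h : ∀ δ : ℝ, 0 < δ → a ≤ b + c * δ) : a ≤ b := by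
  have hlim : Tendsto (fun δ : ℝ => b + c * δ) (𝓝[>] 0) (𝓝 b) := by
    have hc : Continuous fun δ : ℝ => b + c * δ := by fun_prop
    simpa using (hc.tendsto 0).mono_left nhdsWithin_le_nhds
  exact ge_of_tendsto hlim (eventually_mem_nhdsWithin.mono fun δ hδ => h δ hδ)

lemma trace_inv_le {Q : Mat d} {c : ℝ} (hc : 0 < c) (hQ : Q.PosDef)
    (h : (Q - c • (1 : Mat d)).PosSemidef) : Q⁻¹.trace ≤ d / c := by
  have h1 : (c • (1 : Mat d)).PosDef := Matrix.PosDef.one.smul hc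
  have h2 := (posSemidef_inv_sub_inv h1 hQ h).trace_nonneg
  rw [inv_smul_of_posDef hc.ne' Matrix.PosDef.one, inv_one, Matrix.trace_sub, Matrix.trace_smul,
    Matrix.trace_one, Fintype.card_fin, smul_eq_mul] at h2
  rw [div_eq_inv_mul]
  linarith

lemma matInner_inv_le {A Q J : Mat d} {c : ℝ} (hc : 0 < c) (hA : A.PosSemidef) (hQ : Q.PosDef)
    (hJ : J.PosDef) (h : (Q - c • J).PosSemidef) : matInner A Q⁻¹ ≤ matInner A J⁻¹ / c := by
  have h2 := matInner_nonneg hA (posSemidef_inv_sub_inv (hJ.smul hc) hQ h)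
  rw [inv_smul_of_posDef hc.ne' hJ, matInner_sub_right, matInner_smul_right] at h2
  rw [div_eq_inv_mul]
  linarith

/-! ### The regret bound in expectation. -/

/-- Regret bound with the accumulator expanded. -/
lemma IsWeightedRun.regret_le_sum {T : ℕ} (hT : 1 ≤ T) {𝓗 : Set (Mat d)}
    (h𝓗 : IsWellStructured 𝓗) {X : Set (Vec d)} (hX : Convex ℝ X)
    (hXb : Bornology.IsBounded X) {ε β : ℝ} (hε : 0 < ε) (hβ : 0 < β)
    {x₁ : Vec d} (hx₁ : x₁ ∈ X) {ℓ : ℕ → Vec d → ℝ} {x : ℕ → Vec d} {M H : ℕ → Mat d}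
    (h : IsWeightedRun T 𝓗 X ε (√2 * domainNorm 𝓗 X) β x₁ ℓ x M H)
    {u : Vec d} (hu : u ∈ X) {Q : Mat d} (hQ : Q ∈ 𝓗) (hQp : Q.PosDef) :
    ∑ t ∈ Finset.Icc 1 T, β ^ (((T : ℝ) - t) / 2) *
        ((gradient (ℓ t) (x t)).ofLp ⬝ᵥ (x t - u).ofLp) ≤
      ∑ t ∈ Finset.Icc 1 T, β ^ ((T : ℝ) - t) *
        ((gradient (ℓ t) (x t)).ofLp ⬝ᵥ Q⁻¹ *ᵥ (gradient (ℓ t) (x t)).ofLp) +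
      (β ^ (T : ℝ) * ε * Q⁻¹.trace + 2 * domainNorm 𝓗 X ^ 2 * Q.trace) := by
  have h1 := h.regret_le hT h𝓗 hX hXb hε hβ hx₁ hu hQ hQp
  have h2 : ∀ s : Finset ℕ, matInner (∑ t ∈ s, β ^ ((T : ℝ) - t) •
      Matrix.vecMulVec (gradient (ℓ t) (x t)).ofLp (gradient (ℓ t) (x t)).ofLp) Q⁻¹ =
      ∑ t ∈ s, β ^ ((T : ℝ) - t) *
        ((gradient (ℓ t) (x t)).ofLp ⬝ᵥ Q⁻¹ *ᵥ (gradient (ℓ t) (x t)).ofLp) := fun s => by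
    simp only [matInner, Matrix.transpose_sum, Finset.sum_mul, Matrix.trace_sum]
    refine Finset.sum_congr rfl fun t _ => ?_
    rw [← matInner_vecMulVec, ← matInner_smul_left, matInner]
  rw [accum_eq_sum hβ h le_rfl, matInner_add_left, matInner_smul_left, matInner_one_left, h2] at h1
  linarith

/-- First and second moment estimates for the stochastic gradient at a random point of `X` that
is independent of the loss. -/
lemma gradient_moment_estimates {Ω : Type*} [MeasurableSpace Ω] {μ : Measure Ω}
    [IsProbabilityMeasure μ] {ℓ : Ω → Vec d → ℝ} {L : Vec d → ℝ} {U X : Set (Vec d)} {S : Mat d}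
    (hU : Convex ℝ U) (hUi : (interior U).Nonempty) (hXU : X ⊆ U) (hXb : Bornology.IsBounded X)
    (hmeas : Measurable ℓ)
    (hconv : ∀ ω, ConvexOn ℝ Set.univ (ℓ ω)) (hdiff : ∀ ω, Differentiable ℝ (ℓ ω))
    (hint : ∀ x ∈ U, Integrable (fun ω => ℓ ω x) μ) (hexp : ∀ x ∈ U, ∫ ω, ℓ ω x ∂μ = L x)
    (hL : Differentiable ℝ L) (hL' : Differentiable ℝ (fderiv ℝ L))
    (hnoise : NoiseBoundedBy μ X ℓ L S) {ξ : Ω → Vec d} (hξ : Measurable ξ)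
    (hξX : ∀ ω, ξ ω ∈ X) (hindep : IndepFun (fun ω => (⟨ℓ ω, hdiff ω⟩ : DiffFun d)) ξ μ)
    {u : Vec d} (hu : u ∈ X) :
    (∀ Q : Mat d, Q.PosSemidef →
      Integrable (fun ω => (gradient (ℓ ω) (ξ ω)).ofLp ⬝ᵥ Q *ᵥ (gradient (ℓ ω) (ξ ω)).ofLp) μ ∧
      ∫ ω, (gradient (ℓ ω) (ξ ω)).ofLp ⬝ᵥ Q *ᵥ (gradient (ℓ ω) (ξ ω)).ofLp ∂μ ≤
        matInner S Q + ∫ ω, (gradient L (ξ ω)).ofLp ⬝ᵥ Q *ᵥ (gradient L (ξ ω)).ofLp ∂μ) ∧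
    Integrable (fun ω => (gradient (ℓ ω) (ξ ω)).ofLp ⬝ᵥ (ξ ω - u).ofLp) μ ∧
    ∫ ω, (L (ξ ω) - L u) ∂μ ≤ ∫ ω, (gradient (ℓ ω) (ξ ω)).ofLp ⬝ᵥ (ξ ω - u).ofLp ∂μ := by
  have hGc : Continuous fun x => (gradient L x).ofLp :=
    (PiLp.continuous_ofLp 2 _).comp (continuous_gradient hL')
  have hGi : ∀ i, Measurable fun x => (gradient L x).ofLp i := fun i =>
    ((continuous_apply i).comp hGc).measurable
  have hsub : Continuous fun x : Vec d => (x - u).ofLp :=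
    (PiLp.continuous_ofLp 2 _).comp (continuous_id.sub continuous_const)
  have hcn : CenteredNoise μ (fun ω => (⟨ℓ ω, hdiff ω⟩ : DiffFun d)) ξ
      (fun p => (gradient p.1.1 p.2 - gradient L p.2).ofLp) S :=
    { measurable_left := hmeas.subtype_mk
      measurable_right := hξ
      measurable := fun i => measurable_coord (measurable_gradient.sub
        ((continuous_gradient hL').measurable.comp measurable_snd)) i
      indep := hindep
      integrable_mul := fun ω i j => (hnoise (ξ ω) (hξX ω)).1 i j
      second_moment_le := fun ω => (hnoise (ξ ω) (hξX ω)).2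
      centered := fun ω i => NoiseBoundedBy.integral_eq_zero hU hUi hXU hmeas hconv hdiff hint hexp
        hL hnoise (hξX ω) i }
  have hg : ∀ ω, (gradient (ℓ ω) (ξ ω)).ofLp =
      (gradient (ℓ ω) (ξ ω) - gradient L (ξ ω)).ofLp + (gradient L (ξ ω)).ofLp := fun ω => by
    rw [← WithLp.ofLp_add, sub_add_cancel]
  have hdot : Integrable (fun ω => (gradient L (ξ ω)).ofLp ⬝ᵥ (ξ ω - u).ofLp) μ :=
    integrable_of_continuous hXb hξ hξX
      (h := fun x => (gradient L x).ofLp ⬝ᵥ (x - u).ofLp) (hGc.dotProduct hsub)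
  have h1 := hcn.integral_add_dot (g := fun ω => (gradient (ℓ ω) (ξ ω)).ofLp)
    (G := fun x => (gradient L x).ofLp) hg (v := fun x => (x - u).ofLp)
    (fun i => ((continuous_apply i).comp hsub).measurable)
    (fun i => exists_bound_of_continuous hXb hξX ((continuous_apply i).comp hsub)) hdot
  refine ⟨fun Q hQ => ?_, h1.1, ?_⟩
  · have hQG : Continuous fun x => Q *ᵥ (gradient L x).ofLp := continuous_const.matrix_mulVec hGc
    exact hcn.integral_add_quad_le (g := fun ω => (gradient (ℓ ω) (ξ ω)).ofLp)
      (G := fun x => (gradient L x).ofLp) hg hGi hQ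
      (fun i => exists_bound_of_continuous hXb hξX ((continuous_apply i).comp hQG))
      (integrable_of_continuous hXb hξ hξX
        (h := fun x => (gradient L x).ofLp ⬝ᵥ Q *ᵥ (gradient L x).ofLp) (hGc.dotProduct hQG))
  · refine le_of_le_of_eq (integral_mono ?_ hdot fun ω => ?_) h1.2.symm
    · exact integrable_of_continuous hXb hξ hξX (h := fun x => L x - L u)
        (hL.continuous.sub continuous_const)
    · have h2 := gradient_dot_le_of_convexOn (convexOn_expectation hU hconv hint hexp)
        (hXU (hξX ω)) (hXU hu) (hL (ξ ω))
      have e : (u - ξ ω).ofLp = -(ξ ω - u).ofLp := by rw [← WithLp.ofLp_neg, neg_sub]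
      rw [e, dotProduct_neg] at h2
      change L (ξ ω) - L u ≤ (gradient L (ξ ω)).ofLp ⬝ᵥ (ξ ω - u).ofLp
      linarith

/-- Bound on the weighted expected suboptimality, before the free parameters are optimized. -/
lemma sum_suboptimality_le {Ω : Type*} [MeasurableSpace Ω] {μ : Measure Ω}
    [IsProbabilityMeasure μ] {𝓗 : Set (Mat d)} (h𝓗 : IsWellStructured 𝓗)
    {X : Set (Vec d)} (hX : Convex ℝ X) (hXb : Bornology.IsBounded X)
    {T : ℕ} (hT : 1 ≤ T) {ε β : ℝ} (hε : 0 < ε) (hβ : 0 < β) (hβ1 : β ≤ 1)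
    {ℓ : ℕ → Ω → Vec d → ℝ} {L : Vec d → ℝ} {S : Mat d} (hS : S.PosSemidef)
    {xs : Vec d} (hxs : xs ∈ X) (hmin : ∀ y, L xs ≤ L y) {x₁ : Vec d} (hx₁ : x₁ ∈ X)
    {x : ℕ → Ω → Vec d} {M H : ℕ → Ω → Mat d}
    (hrun : ∀ ω, IsWeightedRun T 𝓗 X ε (√2 * domainNorm 𝓗 X) β x₁
      (fun t => ℓ t ω) (fun t => x t ω) (fun t => M t ω) (fun t => H t ω))
    (hx : ∀ t ∈ Finset.Icc 1 T, Measurable (x t))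
    (hquad : ∀ t ∈ Finset.Icc 1 T, ∀ Q : Mat d, Q.PosSemidef →
      Integrable (fun ω => (gradient (ℓ t ω) (x t ω)).ofLp ⬝ᵥ
        Q *ᵥ (gradient (ℓ t ω) (x t ω)).ofLp) μ ∧
      ∫ ω, (gradient (ℓ t ω) (x t ω)).ofLp ⬝ᵥ Q *ᵥ (gradient (ℓ t ω) (x t ω)).ofLp ∂μ ≤
        matInner S Q + ∫ ω, (gradient L (x t ω)).ofLp ⬝ᵥ Q *ᵥ (gradient L (x t ω)).ofLp ∂μ)
    (hlin : ∀ t ∈ Finset.Icc 1 T,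
      Integrable (fun ω => (gradient (ℓ t ω) (x t ω)).ofLp ⬝ᵥ (x t ω - xs).ofLp) μ ∧
      ∫ ω, (L (x t ω) - L xs) ∂μ ≤
        ∫ ω, (gradient (ℓ t ω) (x t ω)).ofLp ⬝ᵥ (x t ω - xs).ofLp ∂μ)
    {P J : Mat d} (hP : P ∈ 𝓗) (hPp : P.PosDef) (hLP : HessianBoundedBy L P) (hJ : J ∈ 𝓗)
    (hJp : J.PosDef) (hJt : J.trace ≤ 1) {a c : ℝ} (ha : 0 < a) (hc : 0 < c) :
    ∑ t ∈ Finset.Icc 1 T, β ^ (((T : ℝ) - t) / 2) * ∫ ω, (L (x t ω) - L xs) ∂μ ≤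
      16 * domainNorm 𝓗 X ^ 2 * P.trace +
      (2 * (∑ t ∈ Finset.Icc 1 T, β ^ ((T : ℝ) - t)) * matInner S J⁻¹ / a +
        4 * domainNorm 𝓗 X ^ 2 * a) +
      (2 * (β ^ (T : ℝ) * ε * d) / c + 4 * domainNorm 𝓗 X ^ 2 * d * c) := by
  set R := domainNorm 𝓗 X with hR
  -- One summand for each term: `4P` for the gradient of `L`, `aJ` for the noise, `cI` for the
  -- initial accumulator.
  set Q : Mat d := (4 : ℝ) • P + a • J + c • (1 : Mat d) with hQdef
  have hQp : Q.PosDef := ((hPp.smul (by norm_num)).add (hJp.smul ha)).add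
    (Matrix.PosDef.one.smul hc)
  have hQ : Q ∈ 𝓗 := add_mem_of_isWellStructured h𝓗 (add_mem_of_isWellStructured h𝓗
    (smul_mem_of_isWellStructured h𝓗 (by norm_num) hP)
    (smul_mem_of_isWellStructured h𝓗 ha.le hJ))
    (smul_mem_of_isWellStructured h𝓗 hc.le (one_mem_of_isWellStructured h𝓗))
  have hP4 := hPp.posSemidef.smul (show (0 : ℝ) ≤ 4 by norm_num)
  have hJa := hJp.posSemidef.smul ha.le
  have h1c := (Matrix.PosSemidef.one (n := Fin d) (R := ℝ)).smul hc.le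
  have hQP : (Q - (4 : ℝ) • P).PosSemidef := by
    rw [show Q - (4 : ℝ) • P = a • J + c • (1 : Mat d) by rw [hQdef]; abel]
    exact hJa.add h1c
  have hQJ : (Q - a • J).PosSemidef := by
    rw [show Q - a • J = (4 : ℝ) • P + c • (1 : Mat d) by rw [hQdef]; abel]
    exact hP4.add h1c
  have hQ1 : (Q - c • (1 : Mat d)).PosSemidef := by
    rw [show Q - c • (1 : Mat d) = (4 : ℝ) • P + a • J by rw [hQdef]; abel]
    exact hP4.add hJa
  have hmem : ∀ t ∈ Finset.Icc 1 T, ∀ ω, x t ω ∈ X := fun t ht ω => (hrun ω).mem hx₁ ht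
  have hLint : ∀ t ∈ Finset.Icc 1 T, Integrable (fun ω => L (x t ω) - L xs) μ := fun t ht =>
    integrable_of_continuous hXb (hx t ht) (hmem t ht) (h := fun y => L y - L xs)
      (hLP.differentiable.continuous.sub continuous_const)
  set e : ℕ → ℝ := fun t => ∫ ω, (L (x t ω) - L xs) ∂μ with he
  have he0 : ∀ t, 0 ≤ e t := fun t => integral_nonneg fun ω => sub_nonneg.2 (hmin _)
  set s := matInner S J⁻¹ with hs
  -- `Q⁻¹ ≼ P⁻¹/4` and `∇Lᵀ P⁻¹ ∇L ≤ 2(L - L(x*))`: the coefficient `4` leaves exactly one half.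
  have hgrad : ∀ y : Vec d, (gradient L y).ofLp ⬝ᵥ Q⁻¹ *ᵥ (gradient L y).ofLp ≤
      (L y - L xs) / 2 := fun y => by
    have h1 := matInner_inv_le (by norm_num : (0 : ℝ) < 4)
      (posSemidef_vecMulVec (gradient L y).ofLp) hQp hPp hQP
    rw [matInner_vecMulVec, matInner_vecMulVec] at h1
    have h2 := hLP.quad_gradient_le hPp hmin y
    linarith
  have hq : ∀ t ∈ Finset.Icc 1 T, ∫ ω, (gradient (ℓ t ω) (x t ω)).ofLp ⬝ᵥ
      Q⁻¹ *ᵥ (gradient (ℓ t ω) (x t ω)).ofLp ∂μ ≤ s / a + e t / 2 := fun t ht => by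
    refine ((hquad t ht Q⁻¹ hQp.posSemidef.inv).2).trans
      (add_le_add (matInner_inv_le ha hS hQp hJp hQJ) ?_)
    rw [he]
    simp only []
    rw [← integral_div]
    exact integral_mono_of_nonneg
      (Eventually.of_forall fun ω => posSemidef_quad_nonneg hQp.posSemidef.inv _)
      ((hLint t ht).div_const 2) (Eventually.of_forall fun ω => hgrad _)
  have hlow : ∑ t ∈ Finset.Icc 1 T, β ^ (((T : ℝ) - t) / 2) * e t ≤
      ∫ ω, ∑ t ∈ Finset.Icc 1 T, β ^ (((T : ℝ) - t) / 2) *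
        ((gradient (ℓ t ω) (x t ω)).ofLp ⬝ᵥ (x t ω - xs).ofLp) ∂μ := by
    rw [integral_finsetSum _ fun t ht => (hlin t ht).1.const_mul _]
    refine Finset.sum_le_sum fun t ht => ?_
    rw [integral_const_mul]
    exact mul_le_mul_of_nonneg_left (hlin t ht).2 (by positivity)
  have hqint : ∀ t ∈ Finset.Icc 1 T, Integrable (fun ω => β ^ ((T : ℝ) - t) *
      ((gradient (ℓ t ω) (x t ω)).ofLp ⬝ᵥ Q⁻¹ *ᵥ (gradient (ℓ t ω) (x t ω)).ofLp)) μ :=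
    fun t ht => (hquad t ht Q⁻¹ hQp.posSemidef.inv).1.const_mul _
  have hup := integral_mono (μ := μ)
    (integrable_finsetSum _ fun t ht => (hlin t ht).1.const_mul (β ^ (((T : ℝ) - t) / 2)))
    ((integrable_finsetSum _ hqint).add
      (integrable_const (β ^ (T : ℝ) * ε * Q⁻¹.trace + 2 * R ^ 2 * Q.trace)))
    (fun ω => (hrun ω).regret_le_sum hT h𝓗 hX hXb hε hβ hx₁ hxs hQ hQp)
  have hsplit := integral_add (integrable_finsetSum (Finset.Icc 1 T) hqint)
    (integrable_const (μ := μ) (β ^ (T : ℝ) * ε * Q⁻¹.trace + 2 * R ^ 2 * Q.trace))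
  rw [integral_finsetSum _ hqint, integral_const, probReal_univ, one_smul] at hsplit
  have hsum : ∑ t ∈ Finset.Icc 1 T, ∫ ω, β ^ ((T : ℝ) - t) *
      ((gradient (ℓ t ω) (x t ω)).ofLp ⬝ᵥ Q⁻¹ *ᵥ (gradient (ℓ t ω) (x t ω)).ofLp) ∂μ ≤
      (∑ t ∈ Finset.Icc 1 T, β ^ ((T : ℝ) - t)) * (s / a) +
        (∑ t ∈ Finset.Icc 1 T, β ^ (((T : ℝ) - t) / 2) * e t) / 2 := by
    rw [Finset.sum_mul, Finset.sum_div, ← Finset.sum_add_distrib]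
    refine Finset.sum_le_sum fun t ht => ?_
    rw [integral_const_mul]
    have hb : 0 < β ^ ((T : ℝ) - t) := by positivity
    have htT : (t : ℝ) ≤ T := by exact_mod_cast (Finset.mem_Icc.1 ht).2
    -- `β ≤ 1` lets the squared weight be replaced by the weight, so the error terms can be absorbed
    -- on the left.
    have hle : β ^ ((T : ℝ) - t) ≤ β ^ (((T : ℝ) - t) / 2) :=
      Real.rpow_le_rpow_of_exponent_ge hβ hβ1 (by linarith)
    have h1 := mul_le_mul_of_nonneg_left (hq t ht) hb.le
    have h2 := mul_le_mul_of_nonneg_right hle (he0 t)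
    linarith
  have htr : Q.trace ≤ 4 * P.trace + a + c * d := by
    rw [hQdef, Matrix.trace_add, Matrix.trace_add, Matrix.trace_smul, Matrix.trace_smul,
      Matrix.trace_smul, Matrix.trace_one, Fintype.card_fin]
    simp only [smul_eq_mul]
    have := mul_le_mul_of_nonneg_left hJt ha.le
    linarith
  have h1 := mul_le_mul_of_nonneg_left htr (by positivity : 0 ≤ 2 * R ^ 2)
  have h2 := mul_le_mul_of_nonneg_left (trace_inv_le hc hQp hQ1)
    (by positivity : 0 ≤ β ^ (T : ℝ) * ε)
  -- Half of the weighted suboptimality moves to the left, and doubling gives the stated constants.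
  have h3 := (hlow.trans hup).trans_eq hsplit
  have e1 : 2 * (∑ t ∈ Finset.Icc 1 T, β ^ ((T : ℝ) - t)) * s / a =
      2 * ((∑ t ∈ Finset.Icc 1 T, β ^ ((T : ℝ) - t)) * (s / a)) := by ring
  have e2 : 2 * (β ^ (T : ℝ) * ε * d) / c = 2 * (β ^ (T : ℝ) * ε * (d / c)) := by ring
  rw [e1, e2]
  linarith

/-! ### Passing to the infima, and the theorem. -/

lemma sqrt_mul_four_sq {A R : ℝ} (hR : 0 ≤ R) :
    2 * √(2 * A * (4 * R ^ 2)) = 4 * √2 * R * √A := by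
  rw [show 2 * A * (4 * R ^ 2) = (2 * R) ^ 2 * (2 * A) by ring, Real.sqrt_mul (by positivity),
    Real.sqrt_sq (by positivity), Real.sqrt_mul (by norm_num)]
  ring

/-- An admissible `P` may be singular, so `P + δI` is used and `δ → 0`. The case `k = 0` is separate
because the infimum is reached after dividing by `k`. -/
lemma smoothness_mul_le {L : Vec d → ℝ} {𝓗 : Set (Mat d)} (h𝓗 : IsWellStructured 𝓗)
    (hsmooth : IsSmooth L 𝓗) {a b k : ℝ} (hk : 0 ≤ k)
    (h : ∀ P ∈ 𝓗, P.PosDef → HessianBoundedBy L P → a ≤ k * P.trace + b) :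
    a ≤ k * smoothness L 𝓗 + b := by
  have h1 : ∀ P ∈ 𝓗, HessianBoundedBy L P → a ≤ k * P.trace + b := by
    intro P hP hLP
    refine le_of_forall_add_mul_le (c := k * d) fun δ hδ => ?_
    have hPs : P.PosSemidef := by obtain ⟨K, rfl⟩ := h𝓗; exact hP.1
    have h2 := h (P + δ • (1 : Mat d)) (add_mem_of_isWellStructured h𝓗 hP
      (smul_mem_of_isWellStructured h𝓗 hδ.le (one_mem_of_isWellStructured h𝓗)))
      (Matrix.PosDef.posSemidef_add hPs (Matrix.PosDef.one.smul hδ))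
      (hLP.mono (by rw [add_sub_cancel_left]; exact Matrix.PosSemidef.one.smul hδ.le))
    rw [Matrix.trace_add, Matrix.trace_smul, Matrix.trace_one, Fintype.card_fin,
      smul_eq_mul] at h2
    linarith
  obtain ⟨P, hP, hLP⟩ := hsmooth
  rcases hk.eq_or_lt with rfl | hk
  · simpa using h1 P hP hLP
  have h3 : (a - b) / k ≤ smoothness L 𝓗 := by
    refine le_csInf ⟨_, P, hP, hLP, rfl⟩ ?_
    rintro _ ⟨P', hP', hLP', rfl⟩
    rw [div_le_iff₀ hk]
    linarith [h1 P' hP' hLP']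
  rw [div_le_iff₀ hk] at h3
  linarith

lemma noiseLevel_mul_le {S : Mat d} {𝓗 : Set (Mat d)} (h𝓗 : IsWellStructured 𝓗)
    {a b k : ℝ} (hk : 0 ≤ k)
    (h : ∀ J ∈ 𝓗, J.PosDef → J.trace ≤ 1 → a ≤ k * √(matInner S J⁻¹) + b) :
    a ≤ k * noiseLevel 𝓗 S + b := by
  obtain ⟨J, hJ, hJp, hJt⟩ : ∃ J ∈ 𝓗, J.PosDef ∧ J.trace ≤ 1 := by
    have hd : (0 : ℝ) < ((d : ℝ) + 1)⁻¹ := by positivity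
    -- `d + 1` instead of `d` also covers dimension zero.
    refine ⟨((d : ℝ) + 1)⁻¹ • 1, smul_mem_of_isWellStructured h𝓗 hd.le
      (one_mem_of_isWellStructured h𝓗), Matrix.PosDef.one.smul hd, ?_⟩
    rw [Matrix.trace_smul, Matrix.trace_one, Fintype.card_fin, smul_eq_mul, inv_mul_le_iff₀
      (by positivity)]
    linarith
  rcases hk.eq_or_lt with rfl | hk
  · simpa using h J hJ hJp hJt
  have h3 : (a - b) / k ≤ noiseLevel 𝓗 S := by
    refine le_csInf ⟨_, J, hJ, hJp, hJt, rfl⟩ ?_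
    rintro _ ⟨J', hJ', hJp', hJt', rfl⟩
    rw [div_le_iff₀ hk]
    linarith [h J' hJ' hJp' hJt']
  rw [div_le_iff₀ hk] at h3
  linarith

lemma noiseLevel_nonneg (𝓗 : Set (Mat d)) (S : Mat d) : 0 ≤ noiseLevel 𝓗 S :=
  Real.sInf_nonneg (by rintro _ ⟨J, _, _, _, rfl⟩; exact Real.sqrt_nonneg _)

end AdaReg

end

theorem mainTheorem8 {d : ℕ} {Ω : Type*} [MeasurableSpace Ω]
    (μ : Measure Ω) [IsProbabilityMeasure μ]
    -- the preconditioner set, the domain and the hyperparameters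
    (𝓗 : Set (AdaReg.Mat d)) (h𝓗 : AdaReg.IsWellStructured 𝓗)
    (X : Set (AdaReg.Vec d)) (hX : Convex ℝ X) (hXb : Bornology.IsBounded X)
    (T : ℕ) (hT : 1 ≤ T) (ε β : ℝ) (hε : 0 < ε) (hβ : 0 < β) (hβ1 : β ≤ 1)
    -- independent random convex differentiable losses
    (ℓ : ℕ → Ω → AdaReg.Vec d → ℝ)
    (hmeas : ∀ t ∈ Finset.Icc 1 T, ∀ x, Measurable fun ω => ℓ t ω x)
    (hindep : iIndepFun (fun (t : Finset.Icc 1 T) (ω : Ω) => ℓ t ω) μ)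
    (hconv : ∀ t ∈ Finset.Icc 1 T, ∀ ω, ConvexOn ℝ Set.univ (ℓ t ω))
    (hdiff : ∀ t ∈ Finset.Icc 1 T, ∀ ω, Differentiable ℝ (ℓ t ω))
    -- their common expectation `L`: on a convex set `U ⊇ X` with nonempty interior, such as
    -- the whole space, or `X` itself if `X` has an interior point
    (L : AdaReg.Vec d → ℝ)
    (U : Set (AdaReg.Vec d)) (hU : Convex ℝ U) (hUi : (interior U).Nonempty) (hXU : X ⊆ U)
    (hint : ∀ t ∈ Finset.Icc 1 T, ∀ x ∈ U, Integrable (fun ω => ℓ t ω x) μ)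
    (hexp : ∀ t ∈ Finset.Icc 1 T, ∀ x ∈ U, ∫ ω, ℓ t ω x ∂μ = L x)
    -- the gradient noise
    (S : AdaReg.Mat d) (hS : S.PosSemidef)
    (hnoise : ∀ t ∈ Finset.Icc 1 T, AdaReg.NoiseBoundedBy μ X (ℓ t) L S)
    -- smoothness of `L` and its global minimizer
    (hsmooth : AdaReg.IsSmooth L 𝓗)
    (xs : AdaReg.Vec d) (hxs : xs ∈ X) (hmin : ∀ y, L xs ≤ L y)
    -- the iterates, with learning rate `√2 ‖X‖_𝓗`
    (x₁ : AdaReg.Vec d) (hx₁ : x₁ ∈ X)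
    (x : ℕ → Ω → AdaReg.Vec d) (M H : ℕ → Ω → AdaReg.Mat d)
    (hrun : ∀ ω, AdaReg.IsWeightedRun T 𝓗 X ε (√2 * AdaReg.domainNorm 𝓗 X) β x₁
      (fun t => ℓ t ω) (fun t => x t ω) (fun t => M t ω) (fun t => H t ω)) :
    Integrable (fun ω => L (AdaReg.weightedAverage T β fun t => x t ω)) μ ∧
    (∫ ω, L (AdaReg.weightedAverage T β fun t => x t ω) ∂μ) - L xs ≤
      16 / (∑ t ∈ Finset.Icc 1 T, β ^ (((T : ℝ) - t) / 2)) *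
          AdaReg.domainNorm 𝓗 X ^ 2 * AdaReg.smoothness L 𝓗 +
        4 * √2 / √(∑ t ∈ Finset.Icc 1 T, β ^ ((T : ℝ) - t)) *
          AdaReg.domainNorm 𝓗 X * AdaReg.noiseLevel 𝓗 S +
        4 * √2 / (∑ t ∈ Finset.Icc 1 T, β ^ (-(t : ℝ) / 2)) *
          AdaReg.domainNorm 𝓗 X * d * √ε := by
  open AdaReg in
  have hne : (Finset.Icc 1 T).Nonempty := ⟨1, by simp [hT]⟩
  have hT' : T ∈ Finset.Icc 1 T := by simp [hT]
  have hmeas' : ∀ t ∈ Finset.Icc 1 T, Measurable (ℓ t) := fun t ht =>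
    measurable_pi_lambda _ (hmeas t ht)
  have hL : Differentiable ℝ L := hsmooth.choose_spec.2.differentiable
  have hL' : Differentiable ℝ (fderiv ℝ L) := hsmooth.choose_spec.2.differentiable_fderiv
  have hLX : ConvexOn ℝ X L :=
    (convexOn_expectation hU (hconv T hT') (hint T hT') (hexp T hT')).subset hXU hX
  have hη : d ≠ 0 → √2 * domainNorm 𝓗 X ≠ 0 := fun hd => by
    have : Nonempty Ω := nonempty_of_isProbabilityMeasure μ
    exact (hrun (Classical.arbitrary Ω)).eta_ne_zero hT h𝓗 hε hβ hd
  have hxm : ∀ t ∈ Finset.Icc 1 T, Measurable (x t) := fun t ht => by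
    have ht' := Finset.mem_Icc.1 ht
    have h := (measurable_iterate h𝓗 hX hη hdiff hrun (t - 1) (by omega) inferInstance
      fun s hs => hmeas' s (by simp at hs ⊢; omega)).1
    rwa [Nat.sub_add_cancel ht'.1] at h
  have hmem : ∀ t ∈ Finset.Icc 1 T, ∀ ω, x t ω ∈ X := fun t ht ω => (hrun ω).mem hx₁ ht
  have hest := fun t ht => gradient_moment_estimates hU hUi hXU hXb (hmeas' t ht) (hconv t ht)
    (hdiff t ht) (hint t ht) (hexp t ht) hL hL' (hnoise t ht) (hxm t ht) (hmem t ht)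
    (indepFun_iterate h𝓗 hX hη hdiff hmeas' hindep hrun ht) hxs
  set R := domainNorm 𝓗 X with hR
  have hR0 : 0 ≤ R := domainNorm_nonneg 𝓗 X
  set W := ∑ t ∈ Finset.Icc 1 T, β ^ (((T : ℝ) - t) / 2) with hW
  set B := ∑ t ∈ Finset.Icc 1 T, β ^ ((T : ℝ) - t) with hB
  have hW0 : 0 < W := Finset.sum_pos (fun t _ => by positivity) hne
  have hB0 : 0 < B := Finset.sum_pos (fun t _ => by positivity) hne
  have hBW : B ≤ W := Finset.sum_le_sum fun t ht => by
    have htT : (t : ℝ) ≤ T := by exact_mod_cast (Finset.mem_Icc.1 ht).2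
    exact Real.rpow_le_rpow_of_exponent_ge hβ hβ1 (by linarith)
  have hsub : ∑ t ∈ Finset.Icc 1 T, β ^ (((T : ℝ) - t) / 2) * ∫ ω, (L (x t ω) - L xs) ∂μ ≤
      16 * R ^ 2 * smoothness L 𝓗 + (4 * √2 * R * √B * noiseLevel 𝓗 S +
        4 * √2 * R * d * √(β ^ (T : ℝ) * ε)) := by
    refine smoothness_mul_le h𝓗 hsmooth (by positivity) fun P hP hPp hLP => ?_
    rw [add_comm, add_assoc]
    refine noiseLevel_mul_le h𝓗 (by positivity) fun J hJ hJp hJt => ?_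
    have hs0 : 0 ≤ matInner S J⁻¹ := matInner_nonneg hS hJp.posSemidef.inv
    -- Optimize `a` for each fixed `c`, then `c`.
    have h1 : ∀ c : ℝ, 0 < c → _ := fun c hc => le_add_two_mul_sqrt
      (a := ∑ t ∈ Finset.Icc 1 T, β ^ (((T : ℝ) - t) / 2) * ∫ ω, (L (x t ω) - L xs) ∂μ)
      (b := 16 * R ^ 2 * P.trace + (2 * (β ^ (T : ℝ) * ε * d) / c + 4 * R ^ 2 * d * c))
      (A := 2 * (B * matInner S J⁻¹)) (B := 4 * R ^ 2) (by positivity) (by positivity)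
      fun a ha => by
        have := sum_suboptimality_le h𝓗 hX hXb hT hε hβ hβ1 hS hxs hmin hx₁ hrun hxm
          (fun t ht => (hest t ht).1) (fun t ht => (hest t ht).2) hP hPp hLP hJ hJp hJt ha hc
        rw [← hB, ← hR] at this
        rw [← mul_assoc 2 B]
        linarith
    have h2 := le_add_two_mul_sqrt
      (a := ∑ t ∈ Finset.Icc 1 T, β ^ (((T : ℝ) - t) / 2) * ∫ ω, (L (x t ω) - L xs) ∂μ)
      (b := 16 * R ^ 2 * P.trace + 2 * √(2 * (B * matInner S J⁻¹) * (4 * R ^ 2)))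
      (A := 2 * (β ^ (T : ℝ) * ε * d)) (B := 4 * R ^ 2 * d) (by positivity) (by positivity)
      fun c hc => by linarith [h1 c hc]
    rw [sqrt_mul_four_sq hR0, Real.sqrt_mul hB0.le,
      show 2 * (β ^ (T : ℝ) * ε * d) * (4 * R ^ 2 * d) =
        2 * (β ^ (T : ℝ) * ε) * (4 * (R * d) ^ 2) by ring, sqrt_mul_four_sq (by positivity)] at h2
    linarith
  have havg : ∀ ω, weightedAverage T β (fun t => x t ω) =
      (Finset.Icc 1 T).centerMass (fun t : ℕ => β ^ (((T : ℝ) - t) / 2)) fun t => x t ω :=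
    fun ω => rfl
  have havgX : ∀ ω, weightedAverage T β (fun t => x t ω) ∈ X := fun ω => by
    rw [havg]
    exact hX.centerMass_mem (fun t _ => by positivity) hW0 fun t ht => hmem t ht ω
  have havgm : Measurable fun ω => weightedAverage T β fun t => x t ω := by
    unfold weightedAverage
    have h : Measurable fun ω => ∑ t ∈ Finset.Icc 1 T, β ^ (((T : ℝ) - t) / 2) • x t ω :=
      Finset.measurable_sum _ fun t ht => (hxm t ht).const_smul (β ^ (((T : ℝ) - t) / 2))
    exact h.const_smul W⁻¹
  have hi := integrable_of_continuous (μ := μ) hXb havgm havgX hL.continuous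
  refine ⟨hi, ?_⟩
  have hLi : ∀ t ∈ Finset.Icc 1 T, Integrable (fun ω => L (x t ω) - L xs) μ := fun t ht =>
    integrable_of_continuous hXb (hxm t ht) (hmem t ht) (h := fun y => L y - L xs)
      (hL.continuous.sub continuous_const)
  have hjensen : (∫ ω, L (weightedAverage T β fun t => x t ω) ∂μ) - L xs ≤
      W⁻¹ * ∑ t ∈ Finset.Icc 1 T, β ^ (((T : ℝ) - t) / 2) * ∫ ω, (L (x t ω) - L xs) ∂μ := by
    have h1 : (∫ ω, L (weightedAverage T β fun t => x t ω) ∂μ) - L xs =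
        ∫ ω, (L (weightedAverage T β fun t => x t ω) - L xs) ∂μ := by
      rw [integral_sub hi (integrable_const _)]; simp
    have h2 : ∑ t ∈ Finset.Icc 1 T, β ^ (((T : ℝ) - t) / 2) * ∫ ω, (L (x t ω) - L xs) ∂μ =
        ∫ ω, ∑ t ∈ Finset.Icc 1 T, β ^ (((T : ℝ) - t) / 2) * (L (x t ω) - L xs) ∂μ := by
      rw [integral_finsetSum _ fun t ht => (hLi t ht).const_mul _]
      simp only [integral_const_mul]
    rw [h1, h2, ← integral_const_mul]
    refine integral_mono (hi.sub (integrable_const _))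
      ((integrable_finsetSum _ fun t ht => (hLi t ht).const_mul _).const_mul _) fun ω => ?_
    have h3 := hLX.map_centerMass_le (t := Finset.Icc 1 T)
      (w := fun t : ℕ => β ^ (((T : ℝ) - t) / 2)) (p := fun t => x t ω)
      (fun t _ => by positivity) hW0 fun t ht => hmem t ht ω
    rw [← havg] at h3
    simp only [Finset.centerMass, smul_eq_mul, Function.comp] at h3
    simp only [mul_sub, Finset.sum_sub_distrib, ← Finset.sum_mul]
    rw [← mul_assoc, ← hW, inv_mul_cancel₀ hW0.ne', one_mul]
    exact sub_le_sub_right h3 _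
  have h1 := hjensen.trans (mul_le_mul_of_nonneg_left hsub (inv_nonneg.2 hW0.le))
  have hσ := noiseLevel_nonneg 𝓗 S
  -- Since `B ≤ W`, `√B / W ≤ √B / B`.
  have hB2 : W⁻¹ * √B ≤ 1 / √B := by
    rw [inv_mul_le_iff₀ hW0, mul_one_div, le_div_iff₀ (Real.sqrt_pos.2 hB0),
      Real.mul_self_sqrt hB0.le]
    exact hBW
  -- Factoring `β^(T/2)` out of `W` cancels the decay of the initial accumulator.
  have hV : W⁻¹ * √(β ^ (T : ℝ)) = 1 / ∑ t ∈ Finset.Icc 1 T, β ^ (-(t : ℝ) / 2) := by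
    have e1 : √(β ^ (T : ℝ)) = β ^ ((T : ℝ) / 2) := by
      rw [Real.sqrt_eq_rpow, ← Real.rpow_mul hβ.le]; congr 1; ring
    have e2 : W = β ^ ((T : ℝ) / 2) * ∑ t ∈ Finset.Icc 1 T, β ^ (-(t : ℝ) / 2) := by
      rw [hW, Finset.mul_sum]
      refine Finset.sum_congr rfl fun t _ => ?_
      rw [← Real.rpow_add hβ]; congr 1; ring
    have e3 : 0 < β ^ ((T : ℝ) / 2) := by positivity
    rw [e1, e2, mul_inv, mul_right_comm, inv_mul_cancel₀ e3.ne', one_mul, one_div]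
  have hmid : W⁻¹ * √B * (4 * √2 * R * noiseLevel 𝓗 S) ≤
      1 / √B * (4 * √2 * R * noiseLevel 𝓗 S) :=
    mul_le_mul_of_nonneg_right hB2 (by positivity)
  calc _ ≤ _ := h1
    _ = W⁻¹ * (16 * R ^ 2 * smoothness L 𝓗) + W⁻¹ * √B * (4 * √2 * R * noiseLevel 𝓗 S) +
        W⁻¹ * √(β ^ (T : ℝ)) * (4 * √2 * R * d * √ε) := by
      rw [Real.sqrt_mul (by positivity)]; ring
    _ ≤ W⁻¹ * (16 * R ^ 2 * smoothness L 𝓗) + 1 / √B * (4 * √2 * R * noiseLevel 𝓗 S) +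
        1 / (∑ t ∈ Finset.Icc 1 T, β ^ (-(t : ℝ) / 2)) * (4 * √2 * R * d * √ε) := by
      rw [hV]; gcongr
    _ = _ := by ring
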